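/- Let $0\le\theta_L<\theta_R$. On a probability space let, for every $N\in\mathbb N$, $U_{1}^{(N)},\dots,U_{N}^{(N)}$ be independent random variables that are uniformly distributed on $[\theta_L,\theta_R]$, and let $\Theta_{1,N}\le\dots\le\Theta_{N,N}$ be their order statistics. Let $\phi:[0,1]\to\mathbb R$ be continuous, let $k\in\mathbb N$, and let $h:[\theta_L,\theta_R]^k\to\mathbb R$ be differentiable with bounded derivative. For $0\le i\le N-k$ put $$(\tau_i h)[\Theta]=h(\Theta_{i+1,N},\dots,\Theta_{i+k,N}),$$ and let $\rho(x)=\theta_L+(\theta_R-\theta_L)x$ for $x\in[0,1]$ and $h'(\theta)=\frac{d}{dt}h(t,\dots,t)\big|_{t=\theta}$ for $\theta\in[\theta_L,\theta_R]$ (one-sided at the end points). Then the random variables $(\tau_i h)[\Theta]$ are integrable, the function $(s,t)\mapsto (s\wedge t-st)\,\phi(s)\phi(t)\,h'(\rho(s))h'(\rho(t))$ is integrable on $[0,1]^2$, the number $$\sigma_T^2=(\theta_R-\theta_L)^2\int_0^1\int_0^1 (s\wedge t-st)\,\phi(s)\phi(t)\,h'(\rho(s))\,h'(\rho(t))\,ds\,dt$$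 is nonnegative, and, as $N\to\infty$, $$\frac1{\sqrt N}\sum_{i=0}^{N-k}\Big((\tau_i h)[\Theta]-\mathbb E\big[(\tau_i h)[\Theta]\big]\Big)\,\phi\Big(\frac iN\Big)\ \longrightarrow\ \mathcal N(0,\sigma_T^2)\quad\text{in distribution.}$$ (If $\sigma_T^2=0$, then $\mathcal N(0,0)$ is the point mass at $0$.) -/

import Mathlib

open MeasureTheory ProbabilityTheory Filter

noncomputable section

/-- The increasing rearrangement of `x₁, …, x_N`, read as a sequence indexed from `1`:
`orderStat x m` is the `m`-th smallest value of the tuple `x` for `1 ≤ m ≤ N`.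
The value `0` at the other indices is a convention that plays no role. -/
def orderStat {N : ℕ} (x : Fin N → ℝ) (m : ℕ) : ℝ :=
  if hm : 1 ≤ m ∧ m ≤ N then x (Tuple.sort x ⟨m - 1, by omega⟩) else 0

/-- The shifted local function `(τ_i f)[x] = f (x_{i+1}, …, x_{i+k})`; the sequence `x` is
indexed from `1`, and the coordinate `j : Fin k` of `f` is its argument number `j + 1`. -/
def shiftLocal {k : ℕ} (i : ℕ) (f : (Fin k → ℝ) → ℝ) (x : ℕ → ℝ) : ℝ :=
  f (fun j : Fin k => x (i + 1 + j))

/-- The cube `[θL, θR]^k`. -/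
def paramCube (θL θR : ℝ) (k : ℕ) : Set (Fin k → ℝ) :=
  Set.univ.pi fun _ => Set.Icc θL θR

/-- The profile `ρ(x) = (θL + (θR - θL) x) 1(0 ≤ x ≤ 1)`. -/
def linProfile (θL θR : ℝ) : ℝ → ℝ :=
  (Set.Icc (0 : ℝ) 1).indicator fun x => θL + (θR - θL) * x

/-- The diagonal derivative `h'(θ) = d/dt h(t, …, t)` at `t = θ`, along `[θL, θR]`
(one-sided at the end points). -/
def diagDeriv (θL θR : ℝ) {k : ℕ} (h : (Fin k → ℝ) → ℝ) (θ : ℝ) : ℝ :=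
  derivWithin (fun t : ℝ => h (fun _ => t)) (Set.Icc θL θR) θ

/-- The integrand `(s ∧ t - s t) φ(s) φ(t) h'(ρ(s)) h'(ρ(t))`. -/
def varKernel (θL θR : ℝ) (φ : ℝ → ℝ) {k : ℕ} (h : (Fin k → ℝ) → ℝ) (s t : ℝ) : ℝ :=
  (min s t - s * t) * φ s * φ t *
    diagDeriv θL θR h (linProfile θL θR s) * diagDeriv θL θR h (linProfile θL θR t)

/-- The asymptotic variance `σ_T²`. -/
def sigmaTSq (θL θR : ℝ) (φ : ℝ → ℝ) {k : ℕ} (h : (Fin k → ℝ) → ℝ) : ℝ :=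
  (θR - θL) ^ 2 * ∫ s in (0 : ℝ)..1, ∫ t in (0 : ℝ)..1, varKernel θL θR φ h s t

end

/-!
The statistic is linearized around the deterministic quantiles, so that the classical central limit
theorem for independent identically distributed variables applies.

After an affine change of variables the sample is uniform on `[0, 1]`, and `h` becomes a function
`g` that is Lipschitz on the cube; it is extended to a globally Lipschitz function, and `φ` to a
bounded uniformly continuous one. Two steps are deterministic.

* Replacing `g (Θ_{i+1}, …, Θ_{i+k})` by `f (Θ_{i+1})`, where `f x = g (x, …, x)`, costs `O(1)` in
  the whole sum, because the gaps between order statistics telescope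
  (`abs_sum_shiftLocal_sub_sum_diag_le`).
* Write `f x = f 1 - ∫ a(t) 1(x ≤ t) dt` with `a = f'`. Then `∑ f (Θ_{i+1}) φ (i / N)` equals
  `f 1 ∑ φ (i / N) - ∫ a(t) S(m_t) dt`, where `m_t` is the number of sample points in `[0, t]` and
  `S(m) = ∑_{i < m} φ (i / N)`. The expansion of `S` around `N t` to first order, with slope
  `φ t`, turns this into a constant plus a sum of influence functions of the individual sample
  points (`abs_sum_orderStat_sub_influence_le`). Only boundedness and measurability of `a` are
  used: it multiplies both sides and is never sampled at particular points.

The error of the expansion is controlled by `∫ (m_t - N t)² dt`, whose mean is at most `N` by the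
binomial variance (`integral_sqDeviation_le`). Hence the total error is `o(√N)` in mean
(`integral_abs_linearizationError_le`), and it is negligible after the centring as well. The sum of
influence functions satisfies the central limit theorem (`tendstoInDistribution_rowSum`). Its
variance is the double integral against the covariance `s ∧ t - s t` of the Brownian bridge
(`integral_influence_sq`), which in particular shows that `σ_T²` is nonnegative.
-/

/-! ### Order statistics -/

lemma orderStat_eq_apply_sort {N m : ℕ} (x : Fin N → ℝ) (h1 : 1 ≤ m) (h2 : m ≤ N) :
    orderStat x m = x (Tuple.sort x ⟨m - 1, by omega⟩) := by
  simp [orderStat, h1, h2]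

/-- An order statistic lies below `t` exactly when enough of the values do. -/
lemma orderStat_le_iff {N m : ℕ} (x : Fin N → ℝ) (h1 : 1 ≤ m) (h2 : m ≤ N) (t : ℝ) :
    orderStat x m ≤ t ↔ m ≤ (Finset.univ.filter fun j => x j ≤ t).card := by
  rw [orderStat_eq_apply_sort x h1 h2]
  have key := Tuple.lt_card_le_iff_apply_le_of_monotone (j := (⟨m - 1, by omega⟩ : Fin N))
    (a := t) (Tuple.monotone_sort x)
  have hcard : (Finset.univ.filter fun j => (x ∘ Tuple.sort x) j ≤ t).card
      = (Finset.univ.filter fun j => x j ≤ t).card :=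
    Finset.card_bij (fun j _ => Tuple.sort x j) (by simp) (by simp)
      (fun b hb => ⟨(Tuple.sort x).symm b, by simpa using hb, by simp⟩)
  rw [hcard] at key
  rw [Function.comp_apply] at key
  rw [← key]
  simp only
  omega

lemma orderStat_mono {N m m' : ℕ} (x : Fin N → ℝ) (h1 : 1 ≤ m) (h : m ≤ m') (h2 : m' ≤ N) :
    orderStat x m ≤ orderStat x m' := by
  rw [orderStat_eq_apply_sort x h1 (h.trans h2), orderStat_eq_apply_sort x (h1.trans h) h2]
  exact Tuple.monotone_sort x (by simp only [Fin.mk_le_mk]; omega)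

/-- No range condition is needed: outside `1 ≤ m ≤ N` the value of `orderStat` is `0`. -/
lemma orderStat_mem_Icc {N : ℕ} {x : Fin N → ℝ} (hx : ∀ j, x j ∈ Set.Icc (0 : ℝ) 1) (m : ℕ) :
    orderStat x m ∈ Set.Icc (0 : ℝ) 1 := by
  unfold orderStat
  split_ifs
  · exact hx _
  · simp

lemma measurable_orderStat (N m : ℕ) : Measurable fun x : Fin N → ℝ => orderStat x m := by
  by_cases hm : 1 ≤ m ∧ m ≤ N
  · refine measurable_of_Iic fun t => ?_
    have : (fun x : Fin N → ℝ => orderStat x m) ⁻¹' Set.Iic t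
        = {x | (m : ℝ) ≤ ∑ j, if x j ≤ t then (1 : ℝ) else 0} := by
      ext x
      simp only [Set.mem_preimage, Set.mem_Iic, Set.mem_ofPred_eq,
        orderStat_le_iff x hm.1 hm.2, Finset.sum_boole, Nat.cast_le]
    rw [this]
    refine measurableSet_le measurable_const (Finset.measurable_sum _ fun j _ => ?_)
    exact Measurable.ite (measurableSet_le (measurable_pi_apply j) measurable_const)
      measurable_const measurable_const
  · have : (fun x : Fin N → ℝ => orderStat x m) = fun _ => 0 := by
      ext x
      simp [orderStat, hm]
    rw [this]
    exact measurable_const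

/-- Order statistics commute with increasing affine maps. -/
lemma orderStat_affine {N m : ℕ} (x : Fin N → ℝ) {c w : ℝ} (hw : 0 ≤ w) (h1 : 1 ≤ m)
    (h2 : m ≤ N) : orderStat (fun j => c + w * x j) m = c + w * orderStat x m := by
  rw [orderStat_eq_apply_sort _ h1 h2, orderStat_eq_apply_sort _ h1 h2]
  have hmono : Monotone ((fun j => c + w * x j) ∘ Tuple.sort x) := fun i j hij => by
    have := Tuple.monotone_sort x hij
    simp only [Function.comp_apply] at this ⊢
    gcongr
  exact (congrFun (Tuple.comp_sort_eq_comp_iff_monotone.mpr hmono) ⟨m - 1, by omega⟩).symm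

/-! ### Deterministic estimates -/

/-- Shifted differences of a `[0, 1]`-valued sequence telescope. -/
lemma sum_shift_sub_le {b : ℕ → ℝ} (hb : ∀ i, b i ∈ Set.Icc (0 : ℝ) 1) (n r : ℕ) :
    ∑ i ∈ Finset.range n, (b (r + i) - b i) ≤ r := by
  have h1 := Finset.sum_range_add b n r
  have h2 := Finset.sum_range_add b r n
  rw [add_comm r n, h1] at h2
  have h3 : ∑ i ∈ Finset.range r, b (n + i) ≤ r := by
    simpa using Finset.sum_le_sum fun i (_ : i ∈ Finset.range r) => (hb (n + i)).2
  have h4 : 0 ≤ ∑ i ∈ Finset.range r, b i := Finset.sum_nonneg fun i _ => (hb i).1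
  rw [Finset.sum_sub_distrib]
  linarith

/-- Replacing every argument of `g` by the first one changes the weighted sum by a bounded
amount, uniformly in `N`: the gaps between order statistics telescope, and the two ranges of
summation differ by at most `k + 1` terms. -/
lemma abs_sum_shiftLocal_sub_sum_diag_le {k N : ℕ} {g : (Fin k → ℝ) → ℝ} {φ : ℝ → ℝ}
    {K : NNReal} {A M : ℝ} (hg : LipschitzWith K g)
    (hgA : ∀ y : Fin k → ℝ, (∀ j, y j ∈ Set.Icc (0 : ℝ) 1) → |g y| ≤ A)
    (hφ : ∀ x, |φ x| ≤ M) {x : Fin N → ℝ} (hx : ∀ j, x j ∈ Set.Icc (0 : ℝ) 1) :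
    |∑ i ∈ Finset.range (N + 1 - k), shiftLocal i g (orderStat x) * φ ((i : ℝ) / N)
      - ∑ i ∈ Finset.range N, g (fun _ => orderStat x (i + 1)) * φ ((i : ℝ) / N)|
      ≤ K * k * M + (k + 1) * (A * M) := by
  have hM : 0 ≤ M := (abs_nonneg _).trans (hφ 0)
  have hA : 0 ≤ A := (abs_nonneg _).trans (hgA 0 (by simp))
  have hterm : ∀ i, |g (fun _ => orderStat x (i + 1)) * φ ((i : ℝ) / N)| ≤ A * M := fun i => by
    rw [abs_mul]
    exact mul_le_mul (hgA _ fun _ => orderStat_mem_Icc hx _) (hφ _) (abs_nonneg _) hA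
  rcases Nat.eq_zero_or_pos k with rfl | hk
  · -- without arguments `g` is constant, and the ranges differ by the term `i = N`
    have hsub : ∀ i, shiftLocal i g (orderStat x) = g (fun _ => orderStat x (i + 1)) := fun i =>
      congrArg g (Subsingleton.elim _ _)
    simp only [hsub, Nat.sub_zero, Finset.sum_range_succ, add_sub_cancel_left]
    simpa using hterm N
  · have hn : N + 1 - k ≤ N := by omega
    have hsplit := Finset.sum_range_add_sum_Ico
      (fun i => g (fun _ => orderStat x (i + 1)) * φ ((i : ℝ) / N)) hn
    rw [← hsplit, ← sub_sub, ← Finset.sum_sub_distrib]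
    refine (abs_sub _ _).trans (add_le_add ?_ ?_)
    · calc |∑ i ∈ Finset.range (N + 1 - k), (shiftLocal i g (orderStat x) * φ ((i : ℝ) / N)
              - g (fun _ => orderStat x (i + 1)) * φ ((i : ℝ) / N))|
          ≤ ∑ i ∈ Finset.range (N + 1 - k),
              K * M * (orderStat x (k - 1 + i + 1) - orderStat x (i + 1)) := by
            refine (Finset.abs_sum_le_sum_abs _ _).trans (Finset.sum_le_sum fun i hi => ?_)
            have hi' := Finset.mem_range.1 hi
            rw [← sub_mul, abs_mul, mul_right_comm]
            refine mul_le_mul ?_ (hφ _) (abs_nonneg _) ?_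
            · have := hg.dist_le_mul (fun j : Fin k => orderStat x (i + 1 + j))
                (fun _ => orderStat x (i + 1))
              refine (Real.dist_eq _ _).symm.le.trans (this.trans ?_)
              refine mul_le_mul_of_nonneg_left ?_ K.2
              refine (dist_pi_le_iff (sub_nonneg.2
                (orderStat_mono x (by omega) (by omega) (by omega)))).2 fun j => ?_
              have hj := j.2
              rw [Real.dist_eq, abs_of_nonneg (sub_nonneg.2
                (orderStat_mono x (by omega) (by omega) (by omega)))]
              exact sub_le_sub_right (orderStat_mono x (by omega) (by omega) (by omega)) _
            · exact mul_nonneg K.2 (sub_nonneg.2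
                (orderStat_mono x (by omega) (by omega) (by omega)))
        _ ≤ K * M * (k - 1 : ℕ) := by
            rw [← Finset.mul_sum]
            exact mul_le_mul_of_nonneg_left
              (sum_shift_sub_le (b := fun i => orderStat x (i + 1))
                (fun i => orderStat_mem_Icc hx _) _ _) (mul_nonneg K.2 hM)
        _ ≤ K * k * M := by
            rw [mul_right_comm]
            have : ((k - 1 : ℕ) : ℝ) ≤ k := by exact_mod_cast Nat.sub_le k 1
            gcongr
    · calc |∑ i ∈ Finset.Ico (N + 1 - k) N, g (fun _ => orderStat x (i + 1)) * φ ((i : ℝ) / N)|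
          ≤ ∑ _i ∈ Finset.Ico (N + 1 - k) N, A * M :=
            (Finset.abs_sum_le_sum_abs _ _).trans (Finset.sum_le_sum fun i _ => hterm i)
        _ ≤ (k + 1) * (A * M) := by
            rw [Finset.sum_const, nsmul_eq_mul, Nat.card_Ico]
            have : ((N - (N + 1 - k) : ℕ) : ℝ) ≤ k + 1 := by
              exact_mod_cast (by omega : N - (N + 1 - k) ≤ k + 1)
            gcongr

/-- A bounded function with a modulus of continuity of the form `ε + C |x - y|`. -/
lemma exists_affine_modulus {φ : ℝ → ℝ} (hφ : UniformContinuous φ) {M : ℝ}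
    (hM : ∀ x, |φ x| ≤ M) {ε : ℝ} (hε : 0 < ε) :
    ∃ C, 0 ≤ C ∧ ∀ x y, |φ x - φ y| ≤ ε + C * |x - y| := by
  have hM0 : 0 ≤ M := (abs_nonneg _).trans (hM 0)
  obtain ⟨δ, hδ, h⟩ := Metric.uniformContinuous_iff.1 hφ ε hε
  refine ⟨2 * M / δ, by positivity, fun x y => ?_⟩
  by_cases hxy : |x - y| < δ
  · have := h (a := x) (b := y) hxy
    rw [Real.dist_eq] at this
    have h2 : 0 ≤ 2 * M / δ * |x - y| := by positivity
    linarith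
  · have h1 : |φ x - φ y| ≤ 2 * M := (abs_sub _ _).trans (by linarith [hM x, hM y])
    have h2 : 2 * M ≤ 2 * M / δ * |x - y| := by
      rw [div_mul_eq_mul_div, le_div_iff₀ hδ]
      exact mul_le_mul_of_nonneg_left (not_lt.1 hxy) (by positivity)
    linarith

/-- First-order expansion of the partial sums of the weights `φ (i / N)` around `N t`. -/
lemma abs_partialSum_sub_linear_le {φ : ℝ → ℝ} {M ε C : ℝ} (hM : ∀ x, |φ x| ≤ M)
    (hC : 0 ≤ C) (hmod : ∀ x y, |φ x - φ y| ≤ ε + C * |x - y|)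
    {N : ℕ} (hN : 0 < N) (m : ℕ) {t : ℝ} (ht : 0 ≤ t) :
    |(∑ i ∈ Finset.range m, φ ((i : ℝ) / N) - ∑ i ∈ Finset.range ⌊N * t⌋₊, φ ((i : ℝ) / N))
        - φ t * (m - N * t)|
      ≤ M + (|m - N * t| + 1) * (ε + C * ((|m - N * t| + 1) / N)) := by
  set n := ⌊N * t⌋₊ with hn
  have hNpos : (0 : ℝ) < N := by exact_mod_cast hN
  have hn1 : (n : ℝ) ≤ N * t := Nat.floor_le (by positivity)
  have hn2 : (N * t : ℝ) < n + 1 := Nat.lt_floor_add_one _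
  have hε : 0 ≤ ε := by simpa using hmod 0 0
  have hclose : ∀ i : ℕ, |(i : ℝ) - N * t| ≤ |m - N * t| + 1 →
      |φ ((i : ℝ) / N) - φ t| ≤ ε + C * ((|m - N * t| + 1) / N) := fun i hi => by
    refine (hmod _ _).trans ?_
    have : (i : ℝ) / N - t = (i - N * t) / N := by field_simp
    rw [this, abs_div, abs_of_pos hNpos]
    gcongr
  have hcount : |(m : ℝ) - n| ≤ |m - N * t| + 1 := by
    have : (m : ℝ) - n = (m - N * t) + (N * t - n) := by ring
    rw [this]
    refine (abs_add_le _ _).trans ?_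
    gcongr
    rw [abs_le]; constructor <;> linarith
  have hmain : |(∑ i ∈ Finset.range m, φ ((i : ℝ) / N) - ∑ i ∈ Finset.range n, φ ((i : ℝ) / N))
        - φ t * (m - n)| ≤ (|m - N * t| + 1) * (ε + C * ((|m - N * t| + 1) / N)) := by
    have hb : 0 ≤ ε + C * ((|m - N * t| + 1) / N) := by positivity
    rcases le_total n m with h | h
    · have e1 : (∑ i ∈ Finset.range m, φ ((i : ℝ) / N) - ∑ i ∈ Finset.range n, φ ((i : ℝ) / N))
          - φ t * (m - n) = ∑ i ∈ Finset.Ico n m, (φ ((i : ℝ) / N) - φ t) := by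
        rw [← Finset.sum_Ico_eq_sub _ h, Finset.sum_sub_distrib, Finset.sum_const, Nat.card_Ico,
          nsmul_eq_mul, Nat.cast_sub h]
        ring
      rw [e1]
      refine (Finset.abs_sum_le_sum_abs _ _).trans ((Finset.sum_le_sum fun i hi => hclose i ?_).trans
        ?_)
      · obtain ⟨h3, h4⟩ := Finset.mem_Ico.1 hi
        have h3' : (n : ℝ) ≤ i := by exact_mod_cast h3
        have h4' : (i : ℝ) ≤ m := by exact_mod_cast h4.le
        have := le_abs_self ((m : ℝ) - N * t)
        have h0 := abs_nonneg ((m : ℝ) - N * t)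
        rw [abs_le]; constructor <;> linarith
      · rw [Finset.sum_const, Nat.card_Ico, nsmul_eq_mul, Nat.cast_sub h]
        gcongr
        exact (le_abs_self _).trans hcount
    · have e1 : (∑ i ∈ Finset.range m, φ ((i : ℝ) / N) - ∑ i ∈ Finset.range n, φ ((i : ℝ) / N))
          - φ t * (m - n) = -∑ i ∈ Finset.Ico m n, (φ ((i : ℝ) / N) - φ t) := by
        rw [Finset.sum_sub_distrib, Finset.sum_Ico_eq_sub _ h, Finset.sum_const, Nat.card_Ico,
          nsmul_eq_mul, Nat.cast_sub h]
        ring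
      rw [e1, abs_neg]
      refine (Finset.abs_sum_le_sum_abs _ _).trans ((Finset.sum_le_sum fun i hi => hclose i ?_).trans
        ?_)
      · obtain ⟨h3, h4⟩ := Finset.mem_Ico.1 hi
        have h3' : (m : ℝ) ≤ i := by exact_mod_cast h3
        have h4' : (i : ℝ) ≤ n := by exact_mod_cast h4.le
        have := neg_abs_le ((m : ℝ) - N * t)
        have h0 := abs_nonneg ((m : ℝ) - N * t)
        rw [abs_le]; constructor <;> linarith
      · rw [Finset.sum_const, Nat.card_Ico, nsmul_eq_mul, Nat.cast_sub h]
        gcongr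
        rw [abs_sub_comm] at hcount
        exact (le_abs_self _).trans hcount
  have hfloor : |φ t * (N * t - n)| ≤ M := by
    rw [abs_mul, abs_of_nonneg (by linarith : 0 ≤ N * t - (n : ℝ))]
    calc |φ t| * (N * t - n) ≤ M * 1 :=
          mul_le_mul (hM t) (by linarith) (by linarith) ((abs_nonneg _).trans (hM t))
      _ = M := mul_one M
  have e2 : (∑ i ∈ Finset.range m, φ ((i : ℝ) / N) - ∑ i ∈ Finset.range n, φ ((i : ℝ) / N))
        - φ t * (m - N * t)
      = φ t * (N * t - n) + ((∑ i ∈ Finset.range m, φ ((i : ℝ) / N)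
        - ∑ i ∈ Finset.range n, φ ((i : ℝ) / N)) - φ t * (m - n)) := by ring
  rw [e2]
  exact (abs_add_le _ _).trans (add_le_add hfloor hmain)

/-- The expansion error in square-mean form, with the weights that suit `(m - N t)² ~ N`. -/
lemma abs_partialSum_sub_linear_le_sq {φ : ℝ → ℝ} {M ε C : ℝ} (hM : ∀ x, |φ x| ≤ M)
    (hC : 0 ≤ C) (hmod : ∀ x y, |φ x - φ y| ≤ ε + C * |x - y|)
    {N : ℕ} (hN : 0 < N) (m : ℕ) {t : ℝ} (ht : 0 ≤ t) :
    |(∑ i ∈ Finset.range m, φ ((i : ℝ) / N) - ∑ i ∈ Finset.range ⌊N * t⌋₊, φ ((i : ℝ) / N))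
        - φ t * (m - N * t)|
      ≤ M + ε * √N + (ε / √N + C / N) * (2 * (m - N * t) ^ 2 + 2) := by
  refine (abs_partialSum_sub_linear_le hM hC hmod hN m ht).trans ?_
  have hε : 0 ≤ ε := by simpa using hmod 0 0
  have hNpos : (0 : ℝ) < N := by exact_mod_cast hN
  have hs : 0 < √(N : ℝ) := Real.sqrt_pos.2 hNpos
  set d := |m - N * t| with hd
  have hd2 : (m - N * t) ^ 2 = d ^ 2 := (sq_abs _).symm
  have hd0 : 0 ≤ d := abs_nonneg _
  rw [hd2]
  have h1 : (d + 1) ^ 2 ≤ 2 * d ^ 2 + 2 := by nlinarith [sq_nonneg (d - 1)]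
  have h2 : (d + 1) ≤ √N + (d + 1) ^ 2 / √N := by
    rw [← sub_le_iff_le_add', le_div_iff₀ hs]
    nlinarith [sq_nonneg (d + 1 - √N), sq_nonneg (d + 1)]
  calc M + (d + 1) * (ε + C * ((d + 1) / N))
      = M + ε * (d + 1) + C / N * (d + 1) ^ 2 := by ring
    _ ≤ M + ε * (√N + (d + 1) ^ 2 / √N) + C / N * (d + 1) ^ 2 := by gcongr
    _ = M + ε * √N + (ε / √N + C / N) * (d + 1) ^ 2 := by ring
    _ ≤ _ := by gcongr

/-! ### The empirical process and the influence function -/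

noncomputable section

/-- The indicator of `x ≤ t`, as a function of `t`: the distribution function of a point mass. -/
def stepAt (x t : ℝ) : ℝ := if x ≤ t then 1 else 0

/-- The indicator of `x ≤ t` centred at its mean `t` under the uniform law on `[0, 1]`. It is
cut off outside `t ∈ [0, 1]`, so that it is bounded by `1` for all arguments. -/
def centredStep (x t : ℝ) : ℝ := if t ∈ Set.Icc (0 : ℝ) 1 then stepAt x t - t else 0

/-- Lebesgue measure on `[0, 1]`, the uniform law, seen as a measure on `ℝ`. -/
abbrev unifMeasure : Measure ℝ := volume.restrict (Set.Icc (0 : ℝ) 1)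

/-- The influence function of the linear statistic with weight `b`: the summand in the
representation of the limiting fluctuations as a sum of independent variables. -/
def influence (b : ℝ → ℝ) (u : ℝ) : ℝ := -∫ t, b t * centredStep u t ∂unifMeasure

/-- The integrated squared deviation of the counts `#{j | x j ≤ t}` from `N t`. -/
def sqDeviation {N : ℕ} (x : Fin N → ℝ) : ℝ := ∫ t, (∑ j, centredStep (x j) t) ^ 2 ∂unifMeasure

end

lemma isProbabilityMeasure_unifMeasure : IsProbabilityMeasure unifMeasure :=
  ⟨by simp⟩

lemma measurable_stepAt : Measurable fun p : ℝ × ℝ => stepAt p.1 p.2 :=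
  Measurable.ite (measurableSet_le measurable_fst measurable_snd) measurable_const measurable_const

lemma measurable_centredStep : Measurable fun p : ℝ × ℝ => centredStep p.1 p.2 :=
  Measurable.ite (measurable_snd measurableSet_Icc) (measurable_stepAt.sub measurable_snd)
    measurable_const

lemma abs_stepAt_le (x t : ℝ) : |stepAt x t| ≤ 1 := by
  unfold stepAt; split_ifs <;> simp

lemma abs_centredStep_le (x t : ℝ) : |centredStep x t| ≤ 1 := by
  unfold centredStep stepAt
  split_ifs with h1 h2
  · rw [abs_le]; constructor <;> linarith [h1.1, h1.2]
  · rw [abs_le]; constructor <;> linarith [h1.1, h1.2]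
  · simp

lemma sum_stepAt_eq_card {N : ℕ} (x : Fin N → ℝ) (t : ℝ) :
    ∑ j, stepAt (x j) t = (Finset.univ.filter fun j => x j ≤ t).card := by
  simp [stepAt, Finset.sum_boole]

lemma sum_centredStep_eq {N : ℕ} (x : Fin N → ℝ) {t : ℝ} (ht : t ∈ Set.Icc (0 : ℝ) 1) :
    ∑ j, centredStep (x j) t = (Finset.univ.filter fun j => x j ≤ t).card - N * t := by
  rw [← sum_stepAt_eq_card]
  simp [centredStep, ht.1, ht.2, Finset.sum_sub_distrib]

lemma abs_sum_centredStep_le {N : ℕ} (x : Fin N → ℝ) (t : ℝ) :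
    |∑ j, centredStep (x j) t| ≤ N := by
  simpa using (Finset.abs_sum_le_sum_abs _ _).trans
    (Finset.sum_le_sum fun j (_ : j ∈ Finset.univ) => abs_centredStep_le (x j) t)

/-- Summing weights over the order statistics below `t` gives a partial sum of the weights. -/
lemma sum_mul_stepAt_orderStat {N : ℕ} (x : Fin N → ℝ) (w : ℕ → ℝ) (t : ℝ) :
    ∑ i ∈ Finset.range N, w i * stepAt (orderStat x (i + 1)) t
      = ∑ i ∈ Finset.range (Finset.univ.filter fun j => x j ≤ t).card, w i := by
  set m := (Finset.univ.filter fun j => x j ≤ t).card with hm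
  have hmN : m ≤ N := (Finset.card_le_univ _).trans (by simp)
  have : ∀ i ∈ Finset.range N, w i * stepAt (orderStat x (i + 1)) t
      = if i < m then w i else 0 := fun i hi => by
    have hi' := Finset.mem_range.1 hi
    simp only [stepAt, orderStat_le_iff x (Nat.le_add_left 1 i) hi', ← hm, Nat.succ_le_iff]
    split_ifs <;> simp
  rw [Finset.sum_congr rfl this, ← Finset.sum_filter]
  congr 1
  ext i
  simp only [Finset.mem_filter, Finset.mem_range]
  omega

lemma integrable_of_measurable_of_abs_le {α : Type*} [MeasurableSpace α] {μ : Measure α}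
    [IsFiniteMeasure μ] {f : α → ℝ} (hf : Measurable f) {C : ℝ} (hC : ∀ x, |f x| ≤ C) :
    Integrable f μ :=
  Integrable.of_bound hf.aestronglyMeasurable C (ae_of_all _ fun x => hC x)

lemma measurable_centredStep_right (x : ℝ) : Measurable fun t => centredStep x t :=
  measurable_centredStep.comp (measurable_const.prodMk measurable_id)

lemma measurable_centredStep_left (t : ℝ) : Measurable fun x => centredStep x t :=
  measurable_centredStep.comp (measurable_id.prodMk measurable_const)

lemma measurable_sum_centredStep {N : ℕ} :
    Measurable fun p : (Fin N → ℝ) × ℝ => ∑ j, centredStep (p.1 j) p.2 :=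
  Finset.measurable_sum _ fun j _ => measurable_centredStep.comp
    (f := fun p : (Fin N → ℝ) × ℝ => (p.1 j, p.2))
    (((measurable_pi_apply j).comp measurable_fst).prodMk measurable_snd)

lemma measurable_sqDeviation {N : ℕ} : Measurable fun x : Fin N → ℝ => sqDeviation x :=
  ((measurable_sum_centredStep.pow_const 2).stronglyMeasurable.integral_prod_right').measurable

lemma measurable_influence {b : ℝ → ℝ} (hb : Measurable b) : Measurable (influence b) := by
  have : Measurable fun p : ℝ × ℝ => b p.2 * centredStep p.1 p.2 :=
    (hb.comp measurable_snd).mul measurable_centredStep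
  exact (this.stronglyMeasurable.integral_prod_right').measurable.neg

lemma abs_mul_centredStep_le {b : ℝ → ℝ} {B : ℝ} (hB : ∀ t, |b t| ≤ B) (u t : ℝ) :
    |b t * centredStep u t| ≤ B := by
  rw [abs_mul]
  calc |b t| * |centredStep u t| ≤ B * 1 :=
        mul_le_mul (hB t) (abs_centredStep_le u t) (abs_nonneg _) ((abs_nonneg _).trans (hB t))
    _ = B := mul_one B

lemma integrable_mul_centredStep {b : ℝ → ℝ} (hb : Measurable b) {B : ℝ} (hB : ∀ t, |b t| ≤ B)
    (u : ℝ) : Integrable (fun t => b t * centredStep u t) unifMeasure :=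
  integrable_of_measurable_of_abs_le (hb.mul (measurable_centredStep_right u))
    (abs_mul_centredStep_le hB u)

lemma abs_influence_le {b : ℝ → ℝ} {B : ℝ} (hB : ∀ t, |b t| ≤ B) (u : ℝ) :
    |influence b u| ≤ B := by
  have := isProbabilityMeasure_unifMeasure
  unfold influence
  rw [abs_neg]
  simpa using norm_integral_le_of_norm_le_const (μ := unifMeasure)
    (f := fun t => b t * centredStep u t) (ae_of_all _ fun t => abs_mul_centredStep_le hB u t)

/-- The heart of the linearization. If `f x = f 1 - ∫ a 1(x ≤ t) dt`, then the sum
`∑ f (Θ_{i+1}) φ (i / N)` is `f 1 ∑ φ (i / N) - ∫ a S(#{j | x j ≤ t}) dt` with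
`S(m) = ∑_{i < m} φ (i / N)`; expanding `S` around `N t` leaves a sum of influence functions. -/
lemma abs_sum_orderStat_sub_influence_le {N : ℕ} (hN : 0 < N) {f φ a : ℝ → ℝ} {M ε C B : ℝ}
    (hφ : Measurable φ) (hM : ∀ x, |φ x| ≤ M) (hC : 0 ≤ C)
    (hmod : ∀ x y, |φ x - φ y| ≤ ε + C * |x - y|) (ha : Measurable a) (hB : ∀ t, |a t| ≤ B)
    (hf : ∀ x ∈ Set.Icc (0 : ℝ) 1, f x = f 1 - ∫ t, a t * stepAt x t ∂unifMeasure)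
    {x : Fin N → ℝ} (hx : ∀ j, x j ∈ Set.Icc (0 : ℝ) 1) :
    |∑ i ∈ Finset.range N, f (orderStat x (i + 1)) * φ ((i : ℝ) / N)
        - (f 1 * ∑ i ∈ Finset.range N, φ ((i : ℝ) / N)
          - ∫ t, a t * ∑ i ∈ Finset.range ⌊N * t⌋₊, φ ((i : ℝ) / N) ∂unifMeasure)
        - ∑ j, influence (fun t => a t * φ t) (x j)|
      ≤ B * (M + ε * √N + (ε / √N + C / N) * (2 * sqDeviation x + 2)) := by
  have hB0 : 0 ≤ B := (abs_nonneg _).trans (hB 0)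
  have hM0 : 0 ≤ M := (abs_nonneg _).trans (hM 0)
  have := isProbabilityMeasure_unifMeasure
  have hstepm : ∀ y : ℝ, Measurable fun t => stepAt y t := fun y =>
    measurable_stepAt.comp (measurable_const.prodMk measurable_id)
  have hi1 : ∀ y, Integrable (fun t => a t * stepAt y t) unifMeasure := fun y =>
    integrable_of_measurable_of_abs_le (ha.mul (hstepm y)) (C := B) fun t => by
      rw [abs_mul]
      exact (mul_le_mul (hB t) (abs_stepAt_le y t) (abs_nonneg _) hB0).trans_eq (mul_one B)
  have hi2 : Integrable (fun t => a t * ∑ i ∈ Finset.range ⌊N * t⌋₊, φ ((i : ℝ) / N))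
      unifMeasure := by
    have hmeas : Measurable fun t : ℝ => ∑ i ∈ Finset.range ⌊N * t⌋₊, φ ((i : ℝ) / N) :=
      (measurable_from_nat (f := fun m : ℕ => ∑ i ∈ Finset.range m, φ ((i : ℝ) / N))).comp
        (Nat.measurable_floor.comp (measurable_id.const_mul (N : ℝ)))
    refine Integrable.of_bound (ha.mul hmeas).aestronglyMeasurable (B * (N * M)) ?_
    filter_upwards [ae_restrict_mem measurableSet_Icc] with t ht
    rw [norm_mul]
    refine mul_le_mul (hB t) ?_ (norm_nonneg _) hB0
    refine (Finset.abs_sum_le_sum_abs _ _).trans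
      ((Finset.sum_le_sum fun (i : ℕ) _ => hM ((i : ℝ) / N)).trans ?_)
    rw [Finset.sum_const, Finset.card_range, nsmul_eq_mul]
    have h1 : (⌊N * t⌋₊ : ℝ) ≤ N * t := Nat.floor_le (by have := ht.1; positivity)
    have h2 : (N : ℝ) * t ≤ N := mul_le_of_le_one_right (Nat.cast_nonneg N) ht.2
    exact mul_le_mul_of_nonneg_right (h1.trans h2) hM0
  have hi3 : ∀ y, Integrable (fun t => a t * φ t * centredStep y t) unifMeasure :=
    integrable_mul_centredStep (ha.mul hφ) (B := B * M) fun t => by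
      rw [abs_mul]; exact mul_le_mul (hB t) (hM t) (abs_nonneg _) hB0
  have hi4 : Integrable (fun t => (∑ j, centredStep (x j) t) ^ 2) unifMeasure :=
    integrable_of_measurable_of_abs_le (C := (N : ℝ) ^ 2)
      ((Finset.measurable_sum _ fun j _ => measurable_centredStep_right (x j)).pow_const 2)
      fun t => by
        rw [abs_pow]
        exact pow_le_pow_left₀ (abs_nonneg _) (abs_sum_centredStep_le x t) 2
  have e1 : ∑ i ∈ Finset.range N, f (orderStat x (i + 1)) * φ ((i : ℝ) / N)
      = f 1 * ∑ i ∈ Finset.range N, φ ((i : ℝ) / N)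
        - ∫ t, ∑ i ∈ Finset.range N, φ ((i : ℝ) / N) * (a t * stepAt (orderStat x (i + 1)) t)
          ∂unifMeasure := by
    rw [integral_finsetSum _ fun i _ => (hi1 _).const_mul _, Finset.mul_sum,
      ← Finset.sum_sub_distrib]
    refine Finset.sum_congr rfl fun i _ => ?_
    rw [hf _ (orderStat_mem_Icc hx _), integral_const_mul]
    ring
  have e2 : ∑ j, influence (fun t => a t * φ t) (x j)
      = -∫ t, ∑ j, a t * φ t * centredStep (x j) t ∂unifMeasure := by
    rw [integral_finsetSum _ fun j _ => hi3 (x j), ← Finset.sum_neg_distrib]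
    rfl
  have hi1' : Integrable (fun t => ∑ i ∈ Finset.range N,
      φ ((i : ℝ) / N) * (a t * stepAt (orderStat x (i + 1)) t)) unifMeasure :=
    integrable_finsetSum _ fun i _ => (hi1 _).const_mul _
  have hi3' : Integrable (fun t => ∑ j, a t * φ t * centredStep (x j) t) unifMeasure :=
    integrable_finsetSum _ fun j _ => hi3 _
  have e3 : ∑ i ∈ Finset.range N, f (orderStat x (i + 1)) * φ ((i : ℝ) / N)
        - (f 1 * ∑ i ∈ Finset.range N, φ ((i : ℝ) / N)
          - ∫ t, a t * ∑ i ∈ Finset.range ⌊N * t⌋₊, φ ((i : ℝ) / N) ∂unifMeasure)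
        - ∑ j, influence (fun t => a t * φ t) (x j)
      = -∫ t, (∑ i ∈ Finset.range N, φ ((i : ℝ) / N) * (a t * stepAt (orderStat x (i + 1)) t)
          - a t * ∑ i ∈ Finset.range ⌊N * t⌋₊, φ ((i : ℝ) / N))
          - ∑ j, a t * φ t * centredStep (x j) t ∂unifMeasure := by
    have hi12 : Integrable (fun t => ∑ i ∈ Finset.range N,
        φ ((i : ℝ) / N) * (a t * stepAt (orderStat x (i + 1)) t)
        - a t * ∑ i ∈ Finset.range ⌊N * t⌋₊, φ ((i : ℝ) / N)) unifMeasure := hi1'.sub hi2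
    rw [integral_sub hi12 hi3', integral_sub hi1' hi2, e1, e2]
    ring
  rw [e3, abs_neg]
  have hi5 : Integrable (fun t => 2 * (∑ j, centredStep (x j) t) ^ 2 + 2) unifMeasure :=
    (hi4.const_mul 2).add (integrable_const _)
  have hi6 : Integrable (fun t => M + ε * √N + (ε / √N + C / N)
      * (2 * (∑ j, centredStep (x j) t) ^ 2 + 2)) unifMeasure :=
    (integrable_const _).add (hi5.const_mul _)
  have hrhs : B * (M + ε * √N + (ε / √N + C / N) * (2 * sqDeviation x + 2))
      = ∫ t, B * (M + ε * √N + (ε / √N + C / N) * (2 * (∑ j, centredStep (x j) t) ^ 2 + 2))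
        ∂unifMeasure := by
    rw [integral_const_mul, integral_add (integrable_const _) (hi5.const_mul _), integral_const_mul,
      integral_add (hi4.const_mul 2) (integrable_const _), integral_const_mul]
    simp [sqDeviation]
  rw [hrhs]
  rw [← Real.norm_eq_abs]
  refine norm_integral_le_of_norm_le (hi6.const_mul _) ?_
  filter_upwards [ae_restrict_mem measurableSet_Icc] with t ht
  have e4 : ∑ i ∈ Finset.range N, φ ((i : ℝ) / N) * (a t * stepAt (orderStat x (i + 1)) t)
      = a t * ∑ i ∈ Finset.range (Finset.univ.filter fun j => x j ≤ t).card, φ ((i : ℝ) / N) := by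
    rw [← sum_mul_stepAt_orderStat x (fun i => φ ((i : ℝ) / N)) t, Finset.mul_sum]
    exact Finset.sum_congr rfl fun i _ => by ring
  rw [e4, ← Finset.mul_sum, sum_centredStep_eq x ht, mul_assoc, ← mul_sub, ← mul_sub, norm_mul]
  exact mul_le_mul (hB t) (abs_partialSum_sub_linear_le_sq hM hC hmod hN _ ht.1)
    (norm_nonneg _) hB0

/-! ### Moments under the uniform law -/

lemma integral_stepAt {t : ℝ} (ht : t ∈ Set.Icc (0 : ℝ) 1) :
    ∫ u, stepAt u t ∂unifMeasure = t := by
  have h1 : (fun u => stepAt u t) = (Set.Iic t).indicator 1 := by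
    ext u; simp [stepAt, Set.indicator]
  rw [h1, integral_indicator_one measurableSet_Iic, measureReal_restrict_apply measurableSet_Iic]
  have : Set.Iic t ∩ Set.Icc (0 : ℝ) 1 = Set.Icc 0 t := by
    ext u
    simp only [Set.mem_inter_iff, Set.mem_Iic, Set.mem_Icc]
    exact ⟨fun h => ⟨h.2.1, h.1⟩, fun h => ⟨h.2, h.1, h.2.trans ht.2⟩⟩
  rw [this, measureReal_def, Real.volume_Icc, sub_zero, ENNReal.toReal_ofReal ht.1]

lemma integrable_stepAt (t : ℝ) : Integrable (fun u => stepAt u t) unifMeasure :=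
  integrable_of_measurable_of_abs_le
    (measurable_stepAt.comp (measurable_id.prodMk measurable_const)) fun u => abs_stepAt_le u t

lemma integral_centredStep (t : ℝ) : ∫ u, centredStep u t ∂unifMeasure = 0 := by
  have := isProbabilityMeasure_unifMeasure
  by_cases ht : t ∈ Set.Icc (0 : ℝ) 1
  · have h0 : (fun u => centredStep u t) = fun u => stepAt u t - t := by
      ext u; exact if_pos ht
    rw [h0, integral_sub (integrable_stepAt t) (integrable_const _), integral_stepAt ht]
    simp
  · have h0 : (fun u => centredStep u t) = fun _ => 0 := by
      ext u; exact if_neg ht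
    rw [h0, integral_zero]

/-- The covariance of the Brownian bridge. -/
lemma integral_centredStep_mul_centredStep {s t : ℝ} (hs : s ∈ Set.Icc (0 : ℝ) 1)
    (ht : t ∈ Set.Icc (0 : ℝ) 1) :
    ∫ u, centredStep u s * centredStep u t ∂unifMeasure = min s t - s * t := by
  have := isProbabilityMeasure_unifMeasure
  have h0 : (fun u => centredStep u s * centredStep u t)
      = fun u => stepAt u (min s t) - t * stepAt u s - s * stepAt u t + s * t := by
    ext u
    rw [centredStep, centredStep, if_pos hs, if_pos ht]
    have : stepAt u (min s t) = stepAt u s * stepAt u t := by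
      simp only [stepAt, le_min_iff]
      split_ifs <;> simp_all
    rw [this]
    ring
  have hmin : min s t ∈ Set.Icc (0 : ℝ) 1 := ⟨le_min hs.1 ht.1, (min_le_left _ _).trans hs.2⟩
  have hi1 : Integrable (fun u => stepAt u (min s t) - t * stepAt u s) unifMeasure :=
    (integrable_stepAt _).sub ((integrable_stepAt _).const_mul _)
  have hi2 : Integrable (fun u => stepAt u (min s t) - t * stepAt u s - s * stepAt u t)
      unifMeasure := hi1.sub ((integrable_stepAt _).const_mul _)
  rw [h0, integral_add hi2 (integrable_const _),
    integral_sub hi1 ((integrable_stepAt _).const_mul _),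
    integral_sub (integrable_stepAt _) ((integrable_stepAt _).const_mul _),
    integral_const_mul, integral_const_mul, integral_stepAt hs, integral_stepAt ht,
    integral_stepAt hmin]
  simp
  ring

lemma integral_influence {b : ℝ → ℝ} (hb : Measurable b) {B : ℝ} (hB : ∀ t, |b t| ≤ B) :
    ∫ u, influence b u ∂unifMeasure = 0 := by
  have hint : Integrable (Function.uncurry fun u t => b t * centredStep u t)
      (unifMeasure.prod unifMeasure) :=
    integrable_of_measurable_of_abs_le ((hb.comp measurable_snd).mul measurable_centredStep)
      fun p => abs_mul_centredStep_le hB p.1 p.2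
  unfold influence
  rw [integral_neg, integral_integral_swap hint]
  simp [integral_const_mul, integral_centredStep]

/-- The variance of the influence function: squaring turns the integral over `t` into a double
integral, and Fubini's theorem brings in the covariance of the Brownian bridge. -/
lemma integral_influence_sq {b : ℝ → ℝ} (hb : Measurable b) {B : ℝ} (hB : ∀ t, |b t| ≤ B) :
    ∫ u, influence b u ^ 2 ∂unifMeasure
      = ∫ s, ∫ t, (min s t - s * t) * b s * b t ∂unifMeasure ∂unifMeasure := by
  have hB0 : 0 ≤ B := (abs_nonneg _).trans (hB 0)
  have hsq : ∀ u, influence b u ^ 2 = ∫ p, (b p.1 * centredStep u p.1) * (b p.2 * centredStep u p.2)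
      ∂(unifMeasure.prod unifMeasure) := fun u => by
    rw [influence, neg_sq, sq]
    exact (integral_prod_mul _ _).symm
  have hprod : ∀ x y : ℝ, |x| ≤ B → |y| ≤ B → |x * y| ≤ B * B := fun x y h1 h2 => by
    rw [abs_mul]; exact mul_le_mul h1 h2 (abs_nonneg _) hB0
  have hmeas : Measurable fun q : ℝ × (ℝ × ℝ) =>
      (b q.2.1 * centredStep q.1 q.2.1) * (b q.2.2 * centredStep q.1 q.2.2) := by
    have h1 : Measurable fun q : ℝ × (ℝ × ℝ) => centredStep q.1 q.2.1 :=
      measurable_centredStep.comp (measurable_fst.prodMk (measurable_fst.comp measurable_snd))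
    have h2 : Measurable fun q : ℝ × (ℝ × ℝ) => centredStep q.1 q.2.2 :=
      measurable_centredStep.comp (measurable_fst.prodMk (measurable_snd.comp measurable_snd))
    exact ((hb.comp (measurable_fst.comp measurable_snd)).mul h1).mul
      ((hb.comp (measurable_snd.comp measurable_snd)).mul h2)
  have hint : Integrable (Function.uncurry fun (u : ℝ) (p : ℝ × ℝ) =>
      (b p.1 * centredStep u p.1) * (b p.2 * centredStep u p.2))
      (unifMeasure.prod (unifMeasure.prod unifMeasure)) :=
    integrable_of_measurable_of_abs_le hmeas fun q =>
      hprod _ _ (abs_mul_centredStep_le hB _ _) (abs_mul_centredStep_le hB _ _)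
  simp only [hsq]
  have hint' : Integrable (fun p : ℝ × ℝ => ∫ u, (b p.1 * centredStep u p.1)
      * (b p.2 * centredStep u p.2) ∂unifMeasure) (unifMeasure.prod unifMeasure) :=
    hint.integral_prod_right
  rw [integral_integral_swap hint, integral_prod _ hint']
  refine setIntegral_congr_fun measurableSet_Icc fun s hs => ?_
  refine setIntegral_congr_fun measurableSet_Icc fun t ht => ?_
  simp only
  rw [← integral_centredStep_mul_centredStep hs ht, ← integral_mul_const, ← integral_mul_const]
  congr 1
  ext u
  ring

section Independent

variable {Ω : Type*} [MeasurableSpace Ω] {P : Measure Ω} [IsProbabilityMeasure P]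

/-- Binomial variance bound for the number of uniform variables below `t`. -/
lemma integral_sum_centredStep_sq_le {N : ℕ} {V : Fin N → Ω → ℝ} (hV : ∀ j, Measurable (V j))
    (hind : iIndepFun V P) (hlaw : ∀ j, P.map (V j) = unifMeasure) (t : ℝ) :
    ∫ ω, (∑ j, centredStep (V j ω) t) ^ 2 ∂P ≤ N := by
  have hm : ∀ j, Measurable fun ω => centredStep (V j ω) t := fun j =>
    (measurable_centredStep_left t).comp (hV j)
  have hL2 : ∀ j, MemLp (fun ω => centredStep (V j ω) t) 2 P := fun j =>
    MemLp.of_bound (hm j).aestronglyMeasurable 1 (ae_of_all _ fun ω => abs_centredStep_le _ _)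
  have hmean : ∀ j, ∫ ω, centredStep (V j ω) t ∂P = 0 := fun j => by
    have := integral_map (hV j).aemeasurable
      ((measurable_centredStep_left t).aestronglyMeasurable (μ := P.map (V j)))
    rw [← this, hlaw j, integral_centredStep]
  have hmean' : ∫ ω, (∑ j, fun ω => centredStep (V j ω) t) ω ∂P = 0 := by
    simp only [Finset.sum_apply]
    rw [integral_finsetSum _ fun j _ => (hL2 j).integrable one_le_two]
    simp [hmean]
  have hvar := IndepFun.variance_sum (μ := P) (s := Finset.univ)
    (X := fun j ω => centredStep (V j ω) t) (fun j _ => hL2 j)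
    (fun i _ j _ hij => (hind.indepFun hij).comp (measurable_centredStep_left t)
      (measurable_centredStep_left t))
  rw [variance_of_integral_eq_zero (Finset.aemeasurable_sum _ fun j _ => (hm j).aemeasurable)
    hmean'] at hvar
  simp only [Finset.sum_apply] at hvar
  rw [hvar]
  have hle : ∀ j, Var[fun ω => centredStep (V j ω) t; P] ≤ 1 := fun j => by
    rw [variance_of_integral_eq_zero (hm j).aemeasurable (hmean j)]
    calc ∫ ω, centredStep (V j ω) t ^ 2 ∂P ≤ ∫ _, (1 : ℝ) ∂P :=
          integral_mono_of_nonneg (ae_of_all _ fun ω => sq_nonneg _) (integrable_const _)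
            (ae_of_all _ fun ω => (sq_le_one_iff_abs_le_one _).2 (abs_centredStep_le _ _))
      _ = 1 := by simp
  simpa using Finset.sum_le_sum fun j (_ : j ∈ Finset.univ) => hle j

lemma sqDeviation_le {N : ℕ} (x : Fin N → ℝ) : |sqDeviation x| ≤ (N : ℝ) ^ 2 := by
  have := isProbabilityMeasure_unifMeasure
  have h : ∀ t, ‖(∑ j, centredStep (x j) t) ^ 2‖ ≤ (N : ℝ) ^ 2 := fun t => by
    rw [norm_pow]
    exact pow_le_pow_left₀ (abs_nonneg _) (abs_sum_centredStep_le x t) 2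
  simpa [sqDeviation] using norm_integral_le_of_norm_le_const (μ := unifMeasure) (ae_of_all _ h)

lemma integral_sqDeviation_le {N : ℕ} {V : Fin N → Ω → ℝ} (hV : ∀ j, Measurable (V j))
    (hind : iIndepFun V P) (hlaw : ∀ j, P.map (V j) = unifMeasure) :
    ∫ ω, sqDeviation (fun j => V j ω) ∂P ≤ N := by
  have := isProbabilityMeasure_unifMeasure
  have hmeas : Measurable fun q : Ω × ℝ => (∑ j, centredStep (V j q.1) q.2) ^ 2 :=
    (measurable_sum_centredStep.comp
      ((measurable_pi_lambda _ fun j => (hV j).comp measurable_fst).prodMk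
        measurable_snd)).pow_const 2
  have hint : Integrable (Function.uncurry fun ω t => (∑ j, centredStep (V j ω) t) ^ 2)
      (P.prod unifMeasure) :=
    integrable_of_measurable_of_abs_le (C := (N : ℝ) ^ 2) hmeas fun q => by
      simp only [Function.uncurry]
      rw [abs_pow]
      exact pow_le_pow_left₀ (abs_nonneg _) (abs_sum_centredStep_le _ _) 2
  unfold sqDeviation
  rw [integral_integral_swap hint]
  calc _ ≤ ∫ _, (N : ℝ) ∂unifMeasure :=
        integral_mono hint.integral_prod_right (integrable_const _)
          fun t => integral_sum_centredStep_sq_le hV hind hlaw t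
    _ = N := by simp

end Independent

/-! ### Central limit theorem for uniform order statistics on the unit interval -/

section CLT

variable {Ω : Type*} [MeasurableSpace Ω] {P : Measure Ω} [IsProbabilityMeasure P]

/-- Central limit theorem for a triangular array whose rows are independent uniform variables.
No relation between different rows is assumed: a row sum has the law of a partial sum of a single
i.i.d. sequence, and convergence in distribution only depends on these laws. -/
lemma tendstoInDistribution_rowSum {V : (N : ℕ) → Fin N → Ω → ℝ}
    (hV : ∀ N j, Measurable (V N j)) (hind : ∀ N, iIndepFun (V N) P)
    (hlaw : ∀ N j, P.map (V N j) = unifMeasure) {F : ℝ → ℝ} (hF : Measurable F) {B : ℝ}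
    (hB : ∀ u, |F u| ≤ B) (hmean : ∫ u, F u ∂unifMeasure = 0) :
    TendstoInDistribution (fun (N : ℕ) ω => (√(N : ℝ))⁻¹ * ∑ j, F (V N j ω)) atTop
      (id : ℝ → ℝ) (fun _ => P) (gaussianReal 0 (∫ u, F u ^ 2 ∂unifMeasure).toNNReal) := by
  have := isProbabilityMeasure_unifMeasure
  obtain ⟨Ω', _, P', X, hX, hXlaw, hXind, _⟩ := exists_iid ℕ unifMeasure
  have hXmap : ∀ n, P'.map (X n) = unifMeasure := fun n => (hXlaw n).map_eq
  have hFX : ∀ n, Measurable fun ω => F (X n ω) := fun n => hF.comp (hX n)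
  have hmeanX : ∫ ω, F (X 0 ω) ∂P' = 0 := by
    rw [← integral_map (hX 0).aemeasurable hF.aestronglyMeasurable, hXmap, hmean]
  have hvarX : Var[fun ω => F (X 0 ω); P'] = ∫ u, F u ^ 2 ∂unifMeasure := by
    rw [variance_of_integral_eq_zero (hFX 0).aemeasurable hmeanX, ← hXmap 0,
      integral_map (hX 0).aemeasurable (hF.pow_const 2).aestronglyMeasurable]
  have hclt := tendstoInDistribution_inv_sqrt_mul_sum_sub (P := P')
    (X := fun n ω => F (X n ω)) (Y := (id : ℝ → ℝ))
    (P' := gaussianReal 0 (∫ u, F u ^ 2 ∂unifMeasure).toNNReal)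
    (by rw [hvarX]; exact HasLaw.id)
    (MemLp.of_bound (hFX 0).aestronglyMeasurable B (ae_of_all _ fun ω => hB _))
    (hXind.comp (fun _ => F) fun _ => hF)
    (fun n => ⟨(hFX n).aemeasurable, (hFX 0).aemeasurable, by
      have h1 := Measure.map_map (μ := P') hF (hX n)
      have h2 := Measure.map_map (μ := P') hF (hX 0)
      rw [hXmap] at h1 h2
      exact h1.symm.trans h2⟩)
  have hrow : ∀ N : ℕ, Measurable fun x : Fin N → ℝ => (√(N : ℝ))⁻¹ * ∑ j, F (x j) := fun N =>
    (Finset.measurable_sum _ fun j _ => hF.comp (measurable_pi_apply j)).const_mul _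
  have hmeas : ∀ N : ℕ, Measurable fun ω => (√(N : ℝ))⁻¹ * ∑ j, F (V N j ω) := fun N =>
    (hrow N).comp (measurable_pi_lambda _ (hV N))
  refine ⟨fun N => (hmeas N).aemeasurable, aemeasurable_id, ?_⟩
  refine hclt.tendsto.congr fun N => Subtype.ext ?_
  -- both laws are images of the product measure on `Fin N → ℝ` under the same function
  have h1 : P.map (fun ω j => V N j ω) = Measure.pi fun _ : Fin N => unifMeasure := by
    rw [(iIndepFun_iff_map_fun_eq_pi_map fun j => (hV N j).aemeasurable).1 (hind N)]
    simp only [hlaw]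
  have h2 : P'.map (fun ω (j : Fin N) => X j ω) = Measure.pi fun _ : Fin N => unifMeasure := by
    rw [(iIndepFun_iff_map_fun_eq_pi_map fun j : Fin N => (hX j).aemeasurable).1
      (hXind.precomp Fin.val_injective)]
    simp only [hXmap]
  have e1 := Measure.map_map (μ := P) (hrow N) (measurable_pi_lambda _ (hV N))
  have e2 := Measure.map_map (μ := P') (hrow N)
    (measurable_pi_lambda (fun ω (j : Fin N) => X j ω) fun j => hX j)
  rw [h1] at e1
  rw [h2] at e2
  simp only [hmeanX, mul_zero, sub_zero, Finset.sum_range]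
  exact e2.symm.trans e1

/-- Slutsky's lemma in the form used here: an error that is negligible in mean does not affect
convergence in distribution. -/
lemma TendstoInDistribution.of_tendsto_integral_abs_sub {Ω' : Type*} [MeasurableSpace Ω']
    {μ' : Measure Ω'} [IsProbabilityMeasure μ'] {X Y : ℕ → Ω → ℝ} {Z : Ω' → ℝ}
    (hX : TendstoInDistribution X atTop Z (fun _ => P) μ')
    (hint : ∀ n, Integrable (fun ω => Y n ω - X n ω) P)
    (hXY : Tendsto (fun n => ∫ ω, |Y n ω - X n ω| ∂P) atTop (nhds 0)) :
    TendstoInDistribution Y atTop Z (fun _ => P) μ' := by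
  refine tendstoInDistribution_of_tendstoInMeasure_sub Y Z hX ?_ fun n => ?_
  · refine tendstoInMeasure_of_tendsto_eLpNorm one_ne_zero
      (fun n => (hint n).aestronglyMeasurable) aestronglyMeasurable_const ?_
    have h : ∀ n, eLpNorm ((Y - X) n - 0) 1 P = ENNReal.ofReal (∫ ω, |Y n ω - X n ω| ∂P) :=
      fun n => by
        rw [sub_zero, eLpNorm_one_eq_lintegral_enorm]
        exact (ofReal_integral_norm_eq_lintegral_enorm (hint n)).symm
    simp only [h]
    simpa using ENNReal.tendsto_ofReal hXY
  · have := (hX.forall_aemeasurable n).add (hint n).aemeasurable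
    refine this.congr (ae_of_all _ fun ω => ?_)
    simp

noncomputable section

/-- The weighted sum `∑_{i=0}^{N-k} (τ_i g)[Θ] φ(i / N)`. -/
def weightedSum {k : ℕ} (g : (Fin k → ℝ) → ℝ) (φ : ℝ → ℝ) {N : ℕ} (x : Fin N → ℝ) : ℝ :=
  ∑ i ∈ Finset.range (N + 1 - k), shiftLocal i g (orderStat x) * φ ((i : ℝ) / N)

/-- What remains of the weighted sum after removing the sum of influence functions and the
deterministic main part, in which the count of sample points in `[0, t]` is replaced by
`⌊N t⌋`. -/
def linearizationError {k : ℕ} (g : (Fin k → ℝ) → ℝ) (φ a : ℝ → ℝ) {N : ℕ} (x : Fin N → ℝ) : ℝ :=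
  weightedSum g φ x
    - (g (fun _ => 1) * ∑ i ∈ Finset.range N, φ ((i : ℝ) / N)
      - ∫ t, a t * ∑ i ∈ Finset.range ⌊N * t⌋₊, φ ((i : ℝ) / N) ∂unifMeasure)
    - ∑ j, influence (fun t => a t * φ t) (x j)

end

lemma measurable_shiftLocal_orderStat {k : ℕ} {g : (Fin k → ℝ) → ℝ} (hg : Measurable g)
    (N i : ℕ) : Measurable fun x : Fin N → ℝ => shiftLocal i g (orderStat x) :=
  hg.comp (measurable_pi_lambda _ fun _ => measurable_orderStat N _)

lemma LipschitzWith.abs_le_on_unit_cube {k : ℕ} {g : (Fin k → ℝ) → ℝ} {K : NNReal}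
    (hg : LipschitzWith K g) {y : Fin k → ℝ} (hy : ∀ j, y j ∈ Set.Icc (0 : ℝ) 1) :
    |g y| ≤ |g 0| + K := by
  have h1 := hg.dist_le_mul y 0
  have h2 : dist y 0 ≤ 1 := (dist_pi_le_iff zero_le_one).2 fun j => by
    rw [Pi.zero_apply, Real.dist_eq, sub_zero, abs_of_nonneg (hy j).1]
    exact (hy j).2
  rw [Real.dist_eq] at h1
  have h3 : (K : ℝ) * dist y 0 ≤ K := mul_le_of_le_one_right K.2 h2
  have h4 := abs_sub_abs_le_abs_sub (g y) (g 0)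
  linarith

/-- The linearization error is `o(√N)`, in terms of the squared deviation of the counts, whose
mean is at most `N`. -/
lemma abs_linearizationError_le {k : ℕ} {g : (Fin k → ℝ) → ℝ} {K : NNReal}
    (hg : LipschitzWith K g) {φ a : ℝ → ℝ} {M B ε C : ℝ} (hφ : Measurable φ)
    (hM : ∀ x, |φ x| ≤ M) (hC : 0 ≤ C) (hmod : ∀ x y, |φ x - φ y| ≤ ε + C * |x - y|)
    (ha : Measurable a) (hB : ∀ t, |a t| ≤ B)
    (hf : ∀ x ∈ Set.Icc (0 : ℝ) 1,
      g (fun _ => x) = g (fun _ => 1) - ∫ t, a t * stepAt x t ∂unifMeasure)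
    {N : ℕ} (hN : 0 < N) {x : Fin N → ℝ} (hx : ∀ j, x j ∈ Set.Icc (0 : ℝ) 1) :
    |linearizationError g φ a x|
      ≤ (K * k * M + (k + 1) * ((|g 0| + K) * M))
        + B * (M + ε * √N + (ε / √N + C / N) * (2 * sqDeviation x + 2)) := by
  have h1 := abs_sum_shiftLocal_sub_sum_diag_le hg (fun y => hg.abs_le_on_unit_cube) hM hx
  have h2 := abs_sum_orderStat_sub_influence_le (f := fun t => g fun _ => t) hN hφ hM hC hmod ha
    hB hf hx
  refine le_trans (le_of_eq ?_) ((abs_add_le _ _).trans (add_le_add h1 h2))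
  congr 1
  unfold linearizationError weightedSum
  ring

lemma integral_abs_linearizationError_le {k : ℕ} {g : (Fin k → ℝ) → ℝ} {K : NNReal}
    (hg : LipschitzWith K g) {φ a : ℝ → ℝ} {M B : ℝ} (hφ : UniformContinuous φ)
    (hM : ∀ x, |φ x| ≤ M) (ha : Measurable a) (hB : ∀ t, |a t| ≤ B)
    (hf : ∀ x ∈ Set.Icc (0 : ℝ) 1,
      g (fun _ => x) = g (fun _ => 1) - ∫ t, a t * stepAt x t ∂unifMeasure)
    {V : (N : ℕ) → Fin N → Ω → ℝ} (hV : ∀ N j, Measurable (V N j))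
    (hV01 : ∀ N j ω, V N j ω ∈ Set.Icc (0 : ℝ) 1) (hind : ∀ N, iIndepFun (V N) P)
    (hlaw : ∀ N j, P.map (V N j) = unifMeasure) {ε : ℝ} (hε : 0 < ε) :
    ∃ C', ∀ N : ℕ, 0 < N →
      ∫ ω, |linearizationError g φ a fun j => V N j ω| ∂P ≤ C' + 5 * B * ε * √N := by
  have hB0 : 0 ≤ B := (abs_nonneg _).trans (hB 0)
  obtain ⟨C, hC, hmod⟩ := exists_affine_modulus hφ hM hε
  refine ⟨(K * k * M + (k + 1) * ((|g 0| + K) * M)) + B * M + 4 * B * C, fun N hN => ?_⟩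
  have hNpos : (0 : ℝ) < N := by exact_mod_cast hN
  have hN1 : (1 : ℝ) ≤ N := by exact_mod_cast hN
  have hs : 0 < √(N : ℝ) := Real.sqrt_pos.2 hNpos
  have hD : Integrable (fun ω => sqDeviation fun j => V N j ω) P :=
    integrable_of_measurable_of_abs_le
      (measurable_sqDeviation.comp (measurable_pi_lambda _ (hV N))) fun ω => sqDeviation_le _
  set L := K * k * M + (k + 1) * ((|g 0| + K) * M) with hL
  set c := ε / √N + C / N with hc
  have hc0 : 0 ≤ c := by positivity
  have hi1 : Integrable (fun ω => c * (2 * sqDeviation (fun j => V N j ω) + 2)) P :=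
    ((hD.const_mul 2).add (integrable_const _)).const_mul c
  have hi2 : Integrable (fun ω => B * (M + ε * √N
      + c * (2 * sqDeviation (fun j => V N j ω) + 2))) P :=
    ((integrable_const _).add hi1).const_mul B
  calc ∫ ω, |linearizationError g φ a fun j => V N j ω| ∂P
      ≤ ∫ ω, L + B * (M + ε * √N + c * (2 * sqDeviation (fun j => V N j ω) + 2)) ∂P :=
        integral_mono_of_nonneg (ae_of_all _ fun ω => abs_nonneg _)
          ((integrable_const _).add hi2) (ae_of_all _ fun ω =>
            abs_linearizationError_le hg hφ.continuous.measurable hM hC hmod ha hB hf hN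
              fun j => hV01 N j ω)
    _ = L + B * (M + ε * √N + c * (2 * ∫ ω, sqDeviation (fun j => V N j ω) ∂P + 2)) := by
        rw [integral_add (integrable_const _) hi2, integral_const_mul,
          integral_add (integrable_const _) hi1, integral_const_mul,
          integral_add (hD.const_mul 2) (integrable_const _), integral_const_mul]
        simp
    _ ≤ L + B * (M + ε * √N + c * (4 * N)) := by
        have := integral_sqDeviation_le (hV N) (hind N) (hlaw N)
        have h4 : 2 * ∫ ω, sqDeviation (fun j => V N j ω) ∂P + 2 ≤ 4 * N := by linarith
        gcongr
    _ = L + B * M + 4 * B * C + 5 * B * ε * √N := by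
        have h1 : ε / √N * N = ε * √N := by
          rw [div_mul_eq_mul_div, div_eq_iff hs.ne', mul_assoc, Real.mul_self_sqrt hNpos.le]
        have h2 : C / N * N = C := div_mul_cancel₀ _ hNpos.ne'
        have h3 : c * (4 * N) = 4 * (ε * √N) + 4 * C := by
          rw [hc]; linear_combination 4 * h1 + 4 * h2
        rw [h3]
        ring

/-- The central limit theorem for uniform order statistics on `[0, 1]`, for a globally Lipschitz
`g` whose restriction to the diagonal has the bounded a.e. derivative `a`. -/
theorem tendstoInDistribution_weightedSum {k : ℕ} {g : (Fin k → ℝ) → ℝ} {K : NNReal}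
    (hg : LipschitzWith K g) {φ a : ℝ → ℝ} {M B : ℝ} (hφ : UniformContinuous φ)
    (hM : ∀ x, |φ x| ≤ M) (ha : Measurable a) (hB : ∀ t, |a t| ≤ B)
    (hf : ∀ x ∈ Set.Icc (0 : ℝ) 1,
      g (fun _ => x) = g (fun _ => 1) - ∫ t, a t * stepAt x t ∂unifMeasure)
    {V : (N : ℕ) → Fin N → Ω → ℝ} (hV : ∀ N j, Measurable (V N j))
    (hV01 : ∀ N j ω, V N j ω ∈ Set.Icc (0 : ℝ) 1) (hind : ∀ N, iIndepFun (V N) P)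
    (hlaw : ∀ N j, P.map (V N j) = unifMeasure) :
    TendstoInDistribution
      (fun (N : ℕ) ω => (√(N : ℝ))⁻¹ * ∑ i ∈ Finset.range (N + 1 - k),
        (shiftLocal i g (orderStat fun j => V N j ω)
          - ∫ ω', shiftLocal i g (orderStat fun j => V N j ω') ∂P) * φ ((i : ℝ) / (N : ℝ)))
      atTop (id : ℝ → ℝ) (fun _ => P)
      (gaussianReal 0 (∫ u, influence (fun t => a t * φ t) u ^ 2 ∂unifMeasure).toNNReal) := by
  have hB0 : 0 ≤ B := (abs_nonneg _).trans (hB 0)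
  have hM0 : 0 ≤ M := (abs_nonneg _).trans (hM 0)
  have hb : Measurable fun t => a t * φ t := ha.mul hφ.continuous.measurable
  have hbB : ∀ t, |a t * φ t| ≤ B * M := fun t => by
    rw [abs_mul]; exact mul_le_mul (hB t) (hM t) (abs_nonneg _) hB0
  have hinfl := measurable_influence hb
  have hpi : ∀ N, Measurable fun ω j => V N j ω := fun N => measurable_pi_lambda _ (hV N)
  have hXint : ∀ N i, Integrable (fun ω => shiftLocal i g (orderStat fun j => V N j ω)) P :=
    fun N i => integrable_of_measurable_of_abs_le
      ((measurable_shiftLocal_orderStat hg.continuous.measurable N i).comp (hpi N))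
      fun ω => hg.abs_le_on_unit_cube fun _ => orderStat_mem_Icc (fun j => hV01 N j ω) _
  have hZint1 : ∀ N j, Integrable (fun ω => influence (fun t => a t * φ t) (V N j ω)) P :=
    fun N j => integrable_of_measurable_of_abs_le (hinfl.comp (hV N j))
      fun ω => abs_influence_le hbB _
  have hZint : ∀ N, Integrable (fun ω => ∑ j, influence (fun t => a t * φ t) (V N j ω)) P :=
    fun N => integrable_finsetSum _ fun j _ => hZint1 N j
  have hZmean : ∀ N, ∫ ω, ∑ j, influence (fun t => a t * φ t) (V N j ω) ∂P = 0 := fun N => by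
    rw [integral_finsetSum _ fun j _ => hZint1 N j]
    refine Finset.sum_eq_zero fun j _ => ?_
    rw [← integral_map (hV N j).aemeasurable hinfl.aestronglyMeasurable, hlaw,
      integral_influence hb hbB]
  have hWint : ∀ N, Integrable (fun ω => weightedSum g φ fun j => V N j ω) P := fun N =>
    integrable_finsetSum _ fun i _ => (hXint N i).mul_const _
  have hRint : ∀ N, Integrable (fun ω => linearizationError g φ a fun j => V N j ω) P := fun N =>
    ((hWint N).sub (integrable_const _)).sub (hZint N)
  have hclt := tendstoInDistribution_rowSum hV hind hlaw hinfl (abs_influence_le hbB)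
    (integral_influence hb hbB)
  -- centring at the mean removes the deterministic part, and the linear part has mean zero
  have hdiff : ∀ (N : ℕ) ω, (√(N : ℝ))⁻¹ * ∑ i ∈ Finset.range (N + 1 - k),
        (shiftLocal i g (orderStat fun j => V N j ω)
          - ∫ ω', shiftLocal i g (orderStat fun j => V N j ω') ∂P) * φ ((i : ℝ) / (N : ℝ))
        - (√(N : ℝ))⁻¹ * ∑ j, influence (fun t => a t * φ t) (V N j ω)
      = (√(N : ℝ))⁻¹ * (linearizationError g φ a (fun j => V N j ω)
          - ∫ ω', linearizationError g φ a (fun j => V N j ω') ∂P) := fun N ω => by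
    have hWmean : ∫ ω', weightedSum g φ (fun j => V N j ω') ∂P
        = ∑ i ∈ Finset.range (N + 1 - k),
          (∫ ω', shiftLocal i g (orderStat fun j => V N j ω') ∂P) * φ ((i : ℝ) / N) := by
      unfold weightedSum
      rw [integral_finsetSum _ fun i _ => (hXint N i).mul_const _]
      exact Finset.sum_congr rfl fun i _ => integral_mul_const _ _
    have hWc : Integrable (fun ω => weightedSum g φ (fun j => V N j ω)
        - (g (fun _ => 1) * ∑ i ∈ Finset.range N, φ ((i : ℝ) / N)
          - ∫ t, a t * ∑ i ∈ Finset.range ⌊N * t⌋₊, φ ((i : ℝ) / N) ∂unifMeasure)) P :=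
      (hWint N).sub (integrable_const _)
    have hRmean : ∫ ω', linearizationError g φ a (fun j => V N j ω') ∂P
        = ∫ ω', weightedSum g φ (fun j => V N j ω') ∂P
          - (g (fun _ => 1) * ∑ i ∈ Finset.range N, φ ((i : ℝ) / N)
            - ∫ t, a t * ∑ i ∈ Finset.range ⌊N * t⌋₊, φ ((i : ℝ) / N) ∂unifMeasure) := by
      unfold linearizationError
      rw [integral_sub hWc (hZint N), hZmean, integral_sub (hWint N) (integrable_const _)]
      simp
    rw [hRmean, hWmean]
    simp only [sub_mul, Finset.sum_sub_distrib]
    unfold linearizationError weightedSum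
    ring
  refine TendstoInDistribution.of_tendsto_integral_abs_sub hclt (fun N => ?_) ?_
  · simp only [hdiff]
    exact ((hRint N).sub (integrable_const _)).const_mul _
  simp only [hdiff]
  have hupper : ∀ N : ℕ, ∫ ω, |(√(N : ℝ))⁻¹ * (linearizationError g φ a (fun j => V N j ω)
          - ∫ ω', linearizationError g φ a (fun j => V N j ω') ∂P)| ∂P
      ≤ (√(N : ℝ))⁻¹ * (2 * ∫ ω, |linearizationError g φ a (fun j => V N j ω)| ∂P) := fun N => by
    have h0 : 0 ≤ (√(N : ℝ))⁻¹ := by positivity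
    simp only [abs_mul, abs_of_nonneg h0]
    rw [integral_const_mul]
    refine mul_le_mul_of_nonneg_left ?_ h0
    calc _ ≤ ∫ ω, (|linearizationError g φ a (fun j => V N j ω)|
            + |∫ ω', linearizationError g φ a (fun j => V N j ω') ∂P|) ∂P :=
          integral_mono ((hRint N).sub (integrable_const _)).abs
            ((hRint N).abs.add (integrable_const _)) fun ω => abs_sub _ _
      _ = ∫ ω, |linearizationError g φ a (fun j => V N j ω)| ∂P
            + |∫ ω', linearizationError g φ a (fun j => V N j ω') ∂P| := by
          rw [integral_add (hRint N).abs (integrable_const _)]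
          simp
      _ ≤ _ := by
          have := abs_integral_le_integral_abs (μ := P)
            (f := fun ω => linearizationError g φ a (fun j => V N j ω))
          linarith
  rw [Metric.tendsto_atTop]
  intro η hη
  obtain ⟨C', hC'⟩ := integral_abs_linearizationError_le hg hφ hM ha hB hf hV hV01 hind hlaw
    (ε := η / (20 * (B + 1))) (by positivity)
  have hlim : Tendsto (fun N : ℕ => (√(N : ℝ))⁻¹ * (2 * C')) atTop (nhds 0) := by
    rw [← zero_mul (2 * C')]
    exact (tendsto_inv_atTop_zero.comp
      (Real.tendsto_sqrt_atTop.comp tendsto_natCast_atTop_atTop)).mul_const _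
  obtain ⟨N₀, hN₀⟩ := eventually_atTop.1 (hlim.eventually (gt_mem_nhds (half_pos hη)))
  refine ⟨max N₀ 1, fun N hN => ?_⟩
  have hN1 : 0 < N := (le_max_right _ _).trans hN
  have hs : 0 < √(N : ℝ) := Real.sqrt_pos.2 (by exact_mod_cast hN1)
  rw [Real.dist_eq, sub_zero, abs_of_nonneg (integral_nonneg fun _ => abs_nonneg _)]
  have hsmall : 5 * B * (η / (20 * (B + 1))) ≤ η / 4 := by
    rw [mul_div_assoc', div_le_div_iff₀ (by positivity) (by norm_num)]
    nlinarith
  calc _ ≤ (√(N : ℝ))⁻¹ * (2 * ∫ ω, |linearizationError g φ a (fun j => V N j ω)| ∂P) := hupper N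
    _ ≤ (√(N : ℝ))⁻¹ * (2 * (C' + 5 * B * (η / (20 * (B + 1))) * √N)) := by
        have := hC' N hN1
        gcongr
    _ = (√(N : ℝ))⁻¹ * (2 * C') + 2 * (5 * B * (η / (20 * (B + 1)))) := by
        field_simp
    _ < η := by
        have := hN₀ N ((le_max_left _ _).trans hN)
        linarith

end CLT

/-! ### Reduction to the unit interval -/

lemma map_affine_unifMeasure {c w : ℝ} (hw : 0 < w) :
    unifMeasure.map (fun x => c + w * x) = ProbabilityTheory.cond volume (Set.Icc c (c + w)) := by
  have hpre : (fun x : ℝ => c + w * x) ⁻¹' Set.Icc c (c + w) = Set.Icc 0 1 := by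
    ext x
    simp only [Set.mem_preimage, Set.mem_Icc]
    constructor
    · rintro ⟨h1, h2⟩
      exact ⟨by nlinarith, by nlinarith⟩
    · rintro ⟨h1, h2⟩
      exact ⟨by nlinarith, by nlinarith⟩
  have hmeas : Measurable fun x : ℝ => c + w * x := by fun_prop
  have hvol : (volume : Measure ℝ).map (fun x => c + w * x) = ENNReal.ofReal w⁻¹ • volume := by
    have h1 := Measure.map_map (μ := (volume : Measure ℝ)) (measurable_const_add c)
      (measurable_const_mul w)
    rw [Real.map_volume_mul_left hw.ne', Measure.map_smul, map_add_left_eq_self,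
      abs_of_pos (inv_pos.2 hw)] at h1
    exact h1.symm
  have h2 := Measure.restrict_map (μ := (volume : Measure ℝ)) hmeas
    (measurableSet_Icc (a := c) (b := c + w))
  rw [hpre, hvol] at h2
  rw [← h2, ProbabilityTheory.cond, Measure.restrict_smul, Real.volume_Icc, add_sub_cancel_left,
    ENNReal.ofReal_inv_of_pos hw]

/-- The inverse of the affine map `x ↦ c + w x`, cut off to take values in `[0, 1]`. -/
noncomputable def toUnit (c w x : ℝ) : ℝ := max 0 (min 1 ((x - c) / w))

lemma toUnit_mem_Icc (c w x : ℝ) : toUnit c w x ∈ Set.Icc (0 : ℝ) 1 :=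
  ⟨le_max_left _ _, max_le zero_le_one (min_le_left _ _)⟩

lemma measurable_toUnit (c w : ℝ) : Measurable (toUnit c w) := by
  unfold toUnit
  fun_prop

lemma affine_toUnit {c w x : ℝ} (hw : 0 < w) (hx : x ∈ Set.Icc c (c + w)) :
    c + w * toUnit c w x = x := by
  have h0 : 0 ≤ (x - c) / w := div_nonneg (by linarith [hx.1]) hw.le
  have h1 : (x - c) / w ≤ 1 := by rw [div_le_one hw]; linarith [hx.2]
  rw [toUnit, min_eq_right h1, max_eq_right h0]
  field_simp
  ring

lemma toUnit_affine {c w x : ℝ} (hw : 0 < w) (hx : x ∈ Set.Icc (0 : ℝ) 1) :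
    toUnit c w (c + w * x) = x := by
  rw [toUnit, add_sub_cancel_left, mul_div_cancel_left₀ _ hw.ne', min_eq_right hx.2,
    max_eq_right hx.1]

lemma map_toUnit_cond {c w : ℝ} (hw : 0 < w) :
    (ProbabilityTheory.cond volume (Set.Icc c (c + w))).map (toUnit c w) = unifMeasure := by
  rw [← map_affine_unifMeasure hw, Measure.map_map (measurable_toUnit c w) (by fun_prop)]
  conv_rhs => rw [← Measure.map_id (μ := unifMeasure)]
  refine Measure.map_congr ?_
  filter_upwards [ae_restrict_mem measurableSet_Icc] with x hx
  exact toUnit_affine hw hx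

lemma affine_mem_paramCube {c d : ℝ} (hcd : c < d) {k : ℕ} {y : Fin k → ℝ}
    (hy : ∀ j, y j ∈ Set.Icc (0 : ℝ) 1) : (fun j => c + (d - c) * y j) ∈ paramCube c d k := by
  intro j _
  have h := hy j
  constructor
  · nlinarith [h.1]
  · nlinarith [h.2]

/-- A function with bounded derivative on the cube agrees there, in unit coordinates, with a
globally Lipschitz function. -/
lemma exists_lipschitz_unit_extension {c d : ℝ} (hcd : c < d) {k : ℕ} {h : (Fin k → ℝ) → ℝ}
    (hdiff : DifferentiableOn ℝ h (paramCube c d k))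
    (hbdd : ∃ C : ℝ, ∀ x ∈ paramCube c d k, ‖fderivWithin ℝ h (paramCube c d k) x‖ ≤ C) :
    ∃ (K : NNReal) (g : (Fin k → ℝ) → ℝ), LipschitzWith K g ∧
      ∀ y : Fin k → ℝ, (∀ j, y j ∈ Set.Icc (0 : ℝ) 1) → h (fun j => c + (d - c) * y j) = g y := by
  obtain ⟨C, hC⟩ := hbdd
  have hw : 0 < d - c := sub_pos.2 hcd
  have hC0 : 0 ≤ C := (norm_nonneg _).trans
    (hC _ (affine_mem_paramCube hcd (y := fun _ : Fin k => 0) (by simp)))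
  have hconv : Convex ℝ (paramCube c d k) := convex_pi fun _ _ => convex_Icc c d
  have hLip : LipschitzOnWith (C * (d - c)).toNNReal
      (fun y : Fin k → ℝ => h fun j => c + (d - c) * y j) {y | ∀ j, y j ∈ Set.Icc (0 : ℝ) 1} := by
    refine LipschitzOnWith.of_dist_le_mul fun y hy z hz => ?_
    rw [Real.coe_toNNReal _ (by positivity), dist_eq_norm]
    refine (hconv.norm_image_sub_le_of_norm_fderivWithin_le hdiff hC
      (affine_mem_paramCube hcd hz) (affine_mem_paramCube hcd hy)).trans ?_
    rw [mul_assoc]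
    refine mul_le_mul_of_nonneg_left ?_ hC0
    have : (fun j => c + (d - c) * y j) - (fun j => c + (d - c) * z j) = (d - c) • (y - z) := by
      ext j
      simp only [Pi.sub_apply, Pi.smul_apply, smul_eq_mul]
      ring
    rw [this, norm_smul, Real.norm_of_nonneg hw.le, dist_eq_norm]
  obtain ⟨g, hg, heq⟩ := hLip.extend_real
  exact ⟨_, g, hg, fun y hy => heq hy⟩

lemma LipschitzWith.comp_diag {k : ℕ} {g : (Fin k → ℝ) → ℝ} {K : NNReal}
    (hg : LipschitzWith K g) : LipschitzWith K fun x : ℝ => g fun _ => x :=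
  LipschitzWith.of_dist_le_mul fun x y => (hg.dist_le_mul _ _).trans
    (mul_le_mul_of_nonneg_left (dist_pi_const_le x y) K.2)

/-- The derivative of `f` on `(0, 1)`, extended by zero. -/
noncomputable def derivOnUnit (f : ℝ → ℝ) (t : ℝ) : ℝ := (Set.Ioo (0 : ℝ) 1).indicator (deriv f) t

lemma measurable_derivOnUnit (f : ℝ → ℝ) : Measurable (derivOnUnit f) :=
  (measurable_deriv f).indicator measurableSet_Ioo

lemma abs_derivOnUnit_le {f : ℝ → ℝ} {K : NNReal} (hf : LipschitzWith K f) (t : ℝ) :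
    |derivOnUnit f t| ≤ K := by
  unfold derivOnUnit Set.indicator
  split_ifs
  · exact norm_deriv_le_of_lipschitz hf
  · simp

/-- The fundamental theorem of calculus in the form of an integral against step functions. -/
lemma eq_sub_integral_derivOnUnit_mul_stepAt {f : ℝ → ℝ} {K : NNReal} (hf : LipschitzWith K f)
    (hdiff : ∀ t ∈ Set.Ioo (0 : ℝ) 1, DifferentiableAt ℝ f t) {x : ℝ}
    (hx : x ∈ Set.Icc (0 : ℝ) 1) :
    f x = f 1 - ∫ t, derivOnUnit f t * stepAt x t ∂unifMeasure := by
  have h1 : ∫ t in x..1, derivOnUnit f t = f 1 - f x := by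
    refine intervalIntegral.integral_eq_sub_of_hasDerivAt_of_le hx.2 hf.continuous.continuousOn
      (fun t ht => ?_) ?_
    · have ht' : t ∈ Set.Ioo (0 : ℝ) 1 := ⟨hx.1.trans_lt ht.1, ht.2⟩
      rw [derivOnUnit, Set.indicator_of_mem ht']
      exact (hdiff t ht').hasDerivAt
    · rw [intervalIntegrable_iff_integrableOn_Icc_of_le hx.2]
      exact integrable_of_measurable_of_abs_le (measurable_derivOnUnit f) (abs_derivOnUnit_le hf)
  have h2 : (fun t => derivOnUnit f t * stepAt x t) = (Set.Ici x).indicator (derivOnUnit f) := by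
    ext t
    simp [stepAt, Set.indicator]
  have h3 : Set.Icc (0 : ℝ) 1 ∩ Set.Ici x = Set.Icc x 1 := by
    ext t
    simp only [Set.mem_inter_iff, Set.mem_Icc, Set.mem_Ici]
    exact ⟨fun h => ⟨h.2, h.1.2⟩, fun h => ⟨⟨hx.1.trans h.1, h.2⟩, h.1⟩⟩
  rw [h2, setIntegral_indicator measurableSet_Ici, h3, integral_Icc_eq_integral_Ioc,
    ← intervalIntegral.integral_of_le hx.2, h1]
  ring

lemma linProfile_eq (c d : ℝ) {t : ℝ} (ht : t ∈ Set.Icc (0 : ℝ) 1) :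
    linProfile c d t = c + (d - c) * t := Set.indicator_of_mem ht _

/-- On the diagonal, the derivative in unit coordinates is the diagonal derivative of `h`
multiplied by the length of the interval. -/
lemma hasDerivAt_diag {c d : ℝ} (hcd : c < d) {k : ℕ} {h g : (Fin k → ℝ) → ℝ}
    (hdiff : DifferentiableOn ℝ h (paramCube c d k))
    (hg : ∀ y : Fin k → ℝ, (∀ j, y j ∈ Set.Icc (0 : ℝ) 1) →
      h (fun j => c + (d - c) * y j) = g y) {t : ℝ} (ht : t ∈ Set.Ioo (0 : ℝ) 1) :
    HasDerivAt (fun x => g fun _ => x) ((d - c) * diagDeriv c d h (linProfile c d t)) t := by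
  have hw : 0 < d - c := sub_pos.2 hcd
  have hmem : linProfile c d t ∈ Set.Ioo c d := by
    rw [linProfile_eq c d (Set.Ioo_subset_Icc_self ht)]
    exact ⟨by nlinarith [ht.1], by nlinarith [ht.2]⟩
  have hnhds : Set.Icc c d ∈ nhds (linProfile c d t) := Icc_mem_nhds hmem.1 hmem.2
  have hH : DifferentiableOn ℝ (fun s : ℝ => h fun _ => s) (Set.Icc c d) :=
    hdiff.comp (g := h) (f := fun (s : ℝ) (_ : Fin k) => s)
      (differentiable_pi.2 fun _ => differentiable_id).differentiableOn fun s hs j _ => hs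
  have hderiv : HasDerivAt (fun s : ℝ => h fun _ => s) (diagDeriv c d h (linProfile c d t))
      (c + (d - c) * t) := by
    rw [← linProfile_eq c d (Set.Ioo_subset_Icc_self ht)]
    exact ((hH _ (Set.Ioo_subset_Icc_self hmem)).hasDerivWithinAt).hasDerivAt hnhds
  have hlin : HasDerivAt (fun x : ℝ => c + (d - c) * x) (d - c) t := by
    simpa using ((hasDerivAt_id t).const_mul (d - c)).const_add c
  have := hderiv.comp t hlin
  rw [mul_comm]
  refine this.congr_of_eventuallyEq ?_
  filter_upwards [Icc_mem_nhds ht.1 ht.2] with x hx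
  exact (hg (fun _ => x) fun _ => hx).symm

lemma derivOnUnit_diag_eq {c d : ℝ} (hcd : c < d) {k : ℕ} {h g : (Fin k → ℝ) → ℝ}
    (hdiff : DifferentiableOn ℝ h (paramCube c d k))
    (hg : ∀ y : Fin k → ℝ, (∀ j, y j ∈ Set.Icc (0 : ℝ) 1) →
      h (fun j => c + (d - c) * y j) = g y) {t : ℝ} (ht : t ∈ Set.Ioo (0 : ℝ) 1) :
    derivOnUnit (fun x => g fun _ => x) t = (d - c) * diagDeriv c d h (linProfile c d t) := by
  rw [derivOnUnit, Set.indicator_of_mem ht, (hasDerivAt_diag hcd hdiff hg ht).deriv]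

/-- A continuous function on `[0, 1]` extends to a bounded uniformly continuous one. -/
lemma exists_uniformContinuous_extension {φ : ℝ → ℝ} (hφ : ContinuousOn φ (Set.Icc 0 1)) :
    ∃ (ψ : ℝ → ℝ) (M : ℝ), UniformContinuous ψ ∧ (∀ x, |ψ x| ≤ M) ∧
      Set.EqOn ψ φ (Set.Icc 0 1) := by
  obtain ⟨M, hM⟩ := isCompact_Icc.exists_bound_of_continuousOn hφ
  refine ⟨fun x => φ (Set.projIcc 0 1 zero_le_one x), M, ?_, fun x => hM _ (Subtype.coe_prop _),
    fun x hx => ?_⟩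
  · exact (CompactSpace.uniformContinuous_of_continuous
      (continuousOn_iff_continuous_domRestrict.1 hφ)).comp
      (LipschitzWith.projIcc zero_le_one).uniformContinuous
  · simp only [Set.projIcc_of_mem zero_le_one hx]

/-! ### The asymptotic variance -/

section Variance

variable {c d : ℝ} {k : ℕ} {h g : (Fin k → ℝ) → ℝ} {φ ψ : ℝ → ℝ}

lemma sq_mul_varKernel_eq (hcd : c < d) (hdiff : DifferentiableOn ℝ h (paramCube c d k))
    (hg : ∀ y : Fin k → ℝ, (∀ j, y j ∈ Set.Icc (0 : ℝ) 1) →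
      h (fun j => c + (d - c) * y j) = g y)
    (hψ : Set.EqOn ψ φ (Set.Icc 0 1)) {s t : ℝ} (hs : s ∈ Set.Ioo (0 : ℝ) 1)
    (ht : t ∈ Set.Ioo (0 : ℝ) 1) :
    (d - c) ^ 2 * varKernel c d φ h s t = (min s t - s * t)
      * (derivOnUnit (fun x => g fun _ => x) s * ψ s)
      * (derivOnUnit (fun x => g fun _ => x) t * ψ t) := by
  rw [derivOnUnit_diag_eq hcd hdiff hg hs, derivOnUnit_diag_eq hcd hdiff hg ht,
    hψ (Set.Ioo_subset_Icc_self hs), hψ (Set.Ioo_subset_Icc_self ht), varKernel]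
  ring

lemma integrableOn_varKernel (hcd : c < d) (hdiff : DifferentiableOn ℝ h (paramCube c d k))
    {K : NNReal} (hgK : LipschitzWith K g)
    (hg : ∀ y : Fin k → ℝ, (∀ j, y j ∈ Set.Icc (0 : ℝ) 1) →
      h (fun j => c + (d - c) * y j) = g y)
    (hψm : Measurable ψ) {M : ℝ} (hM : ∀ x, |ψ x| ≤ M) (hψ : Set.EqOn ψ φ (Set.Icc 0 1)) :
    IntegrableOn (fun p : ℝ × ℝ => varKernel c d φ h p.1 p.2)
      (Set.Icc 0 1 ×ˢ Set.Icc 0 1) volume := by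
  have hw : 0 < d - c := sub_pos.2 hcd
  have hae : (Set.Icc (0 : ℝ) 1 ×ˢ Set.Icc (0 : ℝ) 1 : Set (ℝ × ℝ))
      =ᵐ[volume] (Set.Ioo (0 : ℝ) 1 ×ˢ Set.Ioo (0 : ℝ) 1 : Set (ℝ × ℝ)) :=
    Measure.set_prod_ae_eq Ioo_ae_eq_Icc.symm Ioo_ae_eq_Icc.symm
  rw [integrableOn_congr_set_ae hae]
  set b : ℝ → ℝ := fun t => derivOnUnit (fun x => g fun _ => x) t * ψ t with hb
  have hdiag := hgK.comp_diag
  have hbm : Measurable b := (measurable_derivOnUnit _).mul hψm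
  have hbB : ∀ t, |b t| ≤ K * M := fun t => by
    rw [hb, abs_mul]
    exact mul_le_mul (abs_derivOnUnit_le hdiag t) (hM t) (abs_nonneg _) K.2
  have hS : MeasurableSet (Set.Ioo (0 : ℝ) 1 ×ˢ Set.Ioo (0 : ℝ) 1 : Set (ℝ × ℝ)) :=
    measurableSet_Ioo.prod measurableSet_Ioo
  have hfin : volume (Set.Ioo (0 : ℝ) 1 ×ˢ Set.Ioo (0 : ℝ) 1 : Set (ℝ × ℝ)) ≠ ⊤ := by
    rw [Measure.volume_eq_prod, Measure.prod_prod]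
    simp
  have hint : IntegrableOn (fun p : ℝ × ℝ => ((d - c) ^ 2)⁻¹ *
      ((min p.1 p.2 - p.1 * p.2) * b p.1 * b p.2)) (Set.Ioo 0 1 ×ˢ Set.Ioo 0 1) volume := by
    refine Integrable.const_mul ?_ _
    refine Measure.integrableOn_of_bounded (M := 1 * (K * M) * (K * M)) hfin ?_ ?_
    · exact ((((measurable_fst.min measurable_snd).sub (measurable_fst.mul measurable_snd)).mul
        (hbm.comp measurable_fst)).mul (hbm.comp measurable_snd)).aestronglyMeasurable
    · filter_upwards [ae_restrict_mem hS] with p hp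
      obtain ⟨⟨h1, h2⟩, ⟨h3, h4⟩⟩ := hp
      rw [norm_mul, norm_mul]
      have hB0 : 0 ≤ (K : ℝ) * M := (abs_nonneg _).trans (hbB 0)
      have hk : ‖min p.1 p.2 - p.1 * p.2‖ ≤ 1 := by
        rw [Real.norm_eq_abs, abs_le]
        have := min_le_left p.1 p.2
        have := le_min h1.le h3.le
        constructor <;> nlinarith [mul_pos h1 h3]
      exact mul_le_mul (mul_le_mul hk (hbB _) (norm_nonneg _) zero_le_one) (hbB _)
        (norm_nonneg _) (by positivity)
  refine hint.congr_fun (fun p hp => ?_) hS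
  simp only
  rw [hb, ← sq_mul_varKernel_eq hcd hdiff hg hψ hp.1 hp.2,
    inv_mul_cancel_left₀ (pow_ne_zero 2 hw.ne')]

lemma sigmaTSq_eq_integral_influence_sq (hcd : c < d)
    (hdiff : DifferentiableOn ℝ h (paramCube c d k)) {K : NNReal} (hgK : LipschitzWith K g)
    (hg : ∀ y : Fin k → ℝ, (∀ j, y j ∈ Set.Icc (0 : ℝ) 1) →
      h (fun j => c + (d - c) * y j) = g y)
    (hψm : Measurable ψ) {M : ℝ} (hM : ∀ x, |ψ x| ≤ M) (hψ : Set.EqOn ψ φ (Set.Icc 0 1)) :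
    sigmaTSq c d φ h = ∫ u, influence
      (fun t => derivOnUnit (fun x => g fun _ => x) t * ψ t) u ^ 2 ∂unifMeasure := by
  have hdiag := hgK.comp_diag
  rw [integral_influence_sq (b := fun t => derivOnUnit (fun x => g fun _ => x) t * ψ t)
    ((measurable_derivOnUnit _).mul hψm) (B := K * M) fun t => by
    rw [abs_mul]
    exact mul_le_mul (abs_derivOnUnit_le hdiag t) (hM t) (abs_nonneg _) K.2]
  unfold sigmaTSq
  -- the one-sided derivatives at the end points do not matter: both sides live on `(0, 1)`
  simp only [intervalIntegral.integral_of_le (zero_le_one (α := ℝ)), integral_Icc_eq_integral_Ioc,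
    integral_Ioc_eq_integral_Ioo]
  rw [← integral_const_mul]
  refine setIntegral_congr_fun measurableSet_Ioo fun s hs => ?_
  rw [← integral_const_mul]
  exact setIntegral_congr_fun measurableSet_Ioo fun t ht =>
    sq_mul_varKernel_eq hcd hdiff hg hψ hs ht

end Variance

/-! ### Uniform order statistics on a general interval -/

/-- Central limit theorem for local functions of uniform order statistics. For every `N`, the
random variables `U N j`, `j : Fin N`, are independent and uniform on `[θL, θR]`, and
`Θ_{m,N} = orderStat (U N · ω) m`. The range `i < N + 1 - k` is `0 ≤ i ≤ N - k` when `k ≤ N`,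
and is empty when `N < k`. -/
theorem mainTheorem7
    {Ω : Type*} [MeasurableSpace Ω] (P : Measure Ω) [IsProbabilityMeasure P]
    (θL θR : ℝ) (hθL : 0 ≤ θL) (hθ : θL < θR)
    (U : (N : ℕ) → Fin N → Ω → ℝ)
    (hUindep : ∀ N, iIndepFun (U N) P)
    (hUunif : ∀ N (j : Fin N), pdf.IsUniform (U N j) (Set.Icc θL θR) P volume)
    (φ : ℝ → ℝ) (hφ : ContinuousOn φ (Set.Icc 0 1))
    (k : ℕ) (h : (Fin k → ℝ) → ℝ)
    (hdiff : DifferentiableOn ℝ h (paramCube θL θR k))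
    (hbdd : ∃ C : ℝ, ∀ x ∈ paramCube θL θR k,
      ‖fderivWithin ℝ h (paramCube θL θR k) x‖ ≤ C) :
    (∀ N i : ℕ, i + k ≤ N →
      Integrable (fun ω => shiftLocal i h (orderStat fun j => U N j ω)) P) ∧
    IntegrableOn (fun p : ℝ × ℝ => varKernel θL θR φ h p.1 p.2)
      (Set.Icc 0 1 ×ˢ Set.Icc 0 1) volume ∧
    0 ≤ sigmaTSq θL θR φ h ∧
    TendstoInDistribution
      (fun (N : ℕ) (ω : Ω) =>
        (√(N : ℝ))⁻¹ * ∑ i ∈ Finset.range (N + 1 - k),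
          (shiftLocal i h (orderStat fun j => U N j ω)
              - ∫ ω', shiftLocal i h (orderStat fun j => U N j ω') ∂P)
            * φ ((i : ℝ) / (N : ℝ)))
      atTop (id : ℝ → ℝ) (fun _ => P)
      (gaussianReal 0 (sigmaTSq θL θR φ h).toNNReal) := by
  have hw : 0 < θR - θL := sub_pos.2 hθ
  have hendpoint : θL + (θR - θL) = θR := by ring
  obtain ⟨K, g, hgK, hg⟩ := exists_lipschitz_unit_extension hθ hdiff hbdd
  obtain ⟨ψ, M, hψu, hM, hψ⟩ := exists_uniformContinuous_extension hφ
  have hψm : Measurable ψ := hψu.continuous.measurable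
  have hUm : ∀ N j, AEMeasurable (U N j) P := fun N j =>
    (hUunif N j).aemeasurable (by simp [hθ]) (by simp)
  -- everywhere measurable, `[0, 1]`-valued versions of the variables in unit coordinates
  set V : (N : ℕ) → Fin N → Ω → ℝ := fun N j ω => toUnit θL (θR - θL) ((hUm N j).mk _ ω) with hVdef
  have hV : ∀ N j, Measurable (V N j) := fun N j =>
    (measurable_toUnit _ _).comp (hUm N j).measurable_mk
  have hV01 : ∀ N j ω, V N j ω ∈ Set.Icc (0 : ℝ) 1 := fun N j ω => toUnit_mem_Icc _ _ _
  have hVae : ∀ N j, (fun ω => toUnit θL (θR - θL) (U N j ω)) =ᵐ[P] V N j := fun N j => by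
    filter_upwards [(hUm N j).ae_eq_mk] with ω hω
    simp only [hVdef, ← hω]
  have hind : ∀ N, iIndepFun (V N) P := fun N =>
    ((hUindep N).comp (fun _ => toUnit θL (θR - θL)) fun _ => measurable_toUnit _ _).congr (hVae N)
  have hlaw : ∀ N j, P.map (V N j) = unifMeasure := fun N j => by
    rw [← Measure.map_congr (hVae N j)]
    have h1 := AEMeasurable.map_map_of_aemeasurable
      (measurable_toUnit θL (θR - θL)).aemeasurable (hUm N j)
    have h2 : P.map (U N j) = ProbabilityTheory.cond volume (Set.Icc θL θR) := hUunif N j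
    have h3 := map_toUnit_cond (c := θL) hw
    rw [hendpoint] at h3
    rw [h2, h3] at h1
    exact h1.symm
  have hUV : ∀ N, ∀ᵐ ω ∂P, ∀ j, U N j ω = θL + (θR - θL) * V N j ω := fun N => by
    refine ae_all_iff.2 fun j => ?_
    have hmem : ∀ᵐ ω ∂P, U N j ω ∈ Set.Icc θL θR := by
      refine ae_of_ae_map (hUm N j) ?_
      have h2 : P.map (U N j) = ProbabilityTheory.cond volume (Set.Icc θL θR) := hUunif N j
      rw [h2]
      exact ae_cond_mem measurableSet_Icc
    filter_upwards [hmem, hVae N j] with ω h1 h2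
    rw [← h2, affine_toUnit hw (by rwa [hendpoint])]
  have hX : ∀ N, ∀ᵐ ω ∂P, ∀ i, i + k ≤ N →
      shiftLocal i g (orderStat fun j => V N j ω) = shiftLocal i h (orderStat fun j => U N j ω) :=
    fun N => by
      filter_upwards [hUV N] with ω hω i hi
      unfold shiftLocal
      rw [← hg _ fun _ => orderStat_mem_Icc (fun j => hV01 N j ω) _]
      congr 1
      ext l
      have hl := l.2
      rw [← orderStat_affine _ hw.le (by omega) (by omega)]
      simp only [hω]
  have hXint : ∀ N i, i + k ≤ N → ∫ ω, shiftLocal i g (orderStat fun j => V N j ω) ∂P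
      = ∫ ω, shiftLocal i h (orderStat fun j => U N j ω) ∂P := fun N i hi =>
    integral_congr_ae (by filter_upwards [hX N] with ω hω using hω i hi)
  have hsigma := sigmaTSq_eq_integral_influence_sq hθ hdiff hgK hg hψm hM hψ
  refine ⟨fun N i hi => ?_, integrableOn_varKernel hθ hdiff hgK hg hψm hM hψ, ?_, ?_⟩
  · refine Integrable.congr (integrable_of_measurable_of_abs_le
      ((measurable_shiftLocal_orderStat hgK.continuous.measurable N i).comp
        (measurable_pi_lambda _ (hV N))) fun ω => hgK.abs_le_on_unit_cube fun _ =>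
          orderStat_mem_Icc (fun j => hV01 N j ω) _) ?_
    filter_upwards [hX N] with ω hω using hω i hi
  · rw [hsigma]
    exact integral_nonneg fun _ => sq_nonneg _
  · rw [hsigma]
    refine TendstoInDistribution.congr (fun N => ?_) (ae_of_all _ fun _ => rfl)
      (tendstoInDistribution_weightedSum hgK hψu hM (measurable_derivOnUnit fun x => g fun _ => x)
        (abs_derivOnUnit_le hgK.comp_diag)
        (fun x hx => eq_sub_integral_derivOnUnit_mul_stepAt hgK.comp_diag
          (fun t ht => (hasDerivAt_diag hθ hdiff hg ht).differentiableAt) hx)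
        hV hV01 hind hlaw)
    filter_upwards [hX N] with ω hω
    congr 1
    refine Finset.sum_congr rfl fun i hi => ?_
    have hik : i + k ≤ N := by have := Finset.mem_range.1 hi; omega
    have hmem : (i : ℝ) / N ∈ Set.Icc (0 : ℝ) 1 :=
      ⟨by positivity, div_le_one_of_le₀ (by exact_mod_cast (by omega : i ≤ N)) (by positivity)⟩
    rw [hω i hik, hXint N i hik, hψ hmem]
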